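/- Let $C,B$ be compact connected Riemann surfaces, $n\ge 2$, and let $h:C\to B$ be a holomorphic map of degree $n$, unramified over $e\in B$, with $h^{-1}(e)=\{a_1,\dots,a_n\}$. Let $z_e$ be a local coordinate on $B$ at $e$ (so $z_e(e)=0$), and let $z_j$ be the local coordinate at $a_j$ obtained by restricting $z_e\circ h$ to a neighbourhood of $a_j$. Call $\delta>0$ admissible if the images of $z_e,z_1,\dots,z_n$ contain the disc of radius $\delta$ about $0$ and the coordinate discs $\{|z_j|<\delta\}$, $1\le j\le n$, are pairwise disjoint. For admissible $\delta$ let $\Delta=\{t\in\mathbb C:|t|<\delta^2/4\}$. For $t\in\Delta$ let $D(t)$ be the region in the $w$-plane bounded by the image of the circle $|z|=\delta-\sqrt{|t|}$ under $z\mapsto z+t/z$, and let $V=\{(w,t): t\in\Delta,\ w\in D(t)\}$, with projection $t$ to $\Delta$. Let $S=\{(X,Y): |X|,|Y|<\delta,\ |XY|<\delta^2/4\}$, with projection $t=XY$ to $\Delta$. The Schiffer variation $\mathcal B\to\Delta$ of $B$ centred at $(e,z_e)$ is the complex surface obtained from $B\times\Delta$ by deleting $\{|z_e|\le\sqrt{|t|}\}$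 and glueing the rest to $V$ along $\{\sqrt{|t|}<|z_e|<\delta-\sqrt{|t|}\}$ by $w=z_e+t/z_e$. The diagonal one-parameter Fay–Schiffer variation $\mathcal C\to\Delta$ of $C$ centred at $(a_1,z_1;\dots;a_n,z_n)$ is the complex surface obtained from $C\times\Delta$ by deleting $\{|z_j|\le\sqrt{|t|}\}$ for $j\le n-2$ and $\{|z_j|\le|t|/\delta\}$ for $j=n-1,n$, and glueing the rest to a copy of $V$ for each $j\le n-2$, along $\{\sqrt{|t|}<|z_j|<\delta-\sqrt{|t|}\}$ by $w=z_j+t/z_j$, and to one copy of $S$, along $\{|z_{n-1}|<\delta\}$ by $X=z_{n-1},\ Y=t/z_{n-1}$ and along $\{|z_n|<\delta\}$ by $X=t/z_n,\ Y=z_n$. Thus the same parameter $t$ is used at all the centres. The fibre $\mathcal C_0$ is identified with the nodal curve $C/(a_{n-1}\sim a_n)$, and $\mathcal B_0$ with $B$. Then every sufficiently small $\delta>0$ is admissible, and for every admissible $\delta$ there is a holomorphic map $H:\mathcal C\to\mathcal B$ over $\Delta$ such that for every $t\in\Delta$ the map $H_t:\mathcal C_t\to\mathcal B_t$ has degree $n$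 (its fibres are finite and all but finitely many of them have exactly $n$ points), and such that $H_0$ is the map $C/(a_{n-1}\sim a_n)\to B$ induced by $h$. -/

import Mathlib

open Set Filter Topology
open scoped Manifold ContDiff

namespace FaySchiffer

/-- `f` has degree `n`: its fibres are finite and all but finitely many of them have exactly `n`
points.  For a nonconstant holomorphic map between compact connected (possibly nodal, irreducible)
curves this is the usual degree. -/
def HasDegree {X Y : Type*} (f : X → Y) (n : ℕ) : Prop :=
  (∀ y, (f ⁻¹' {y}).Finite) ∧ {y | (f ⁻¹' {y}).ncard ≠ n}.Finite

/-- The Riemann surface `X` with the two points `p` and `q` identified: `X/(p ∼ q)`. -/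
def Nodal {X : Type*} (p q : X) : Type _ := Quot (fun x y : X => x = p ∧ y = q)

/-- The map `X/(p ∼ q) → Y` induced by a map `h : X → Y` with `h p = h q`. -/
def Nodal.map {X Y : Type*} {p q : X} (h : X → Y) (hpq : h p = h q) : Nodal p q → Y :=
  Quot.lift h (by rintro x y ⟨rfl, rfl⟩; exact hpq)

theorem map_eq_of_range {ι X Y : Type*} {a : ι → X} {h : X → Y} {e : Y}
    (hae : range a = h ⁻¹' {e}) (i i' : ι) : h (a i) = h (a i') := by
  have key : ∀ i, h (a i) = e := fun i => by
    have : a i ∈ h ⁻¹' {e} := hae ▸ mem_range_self i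
    exact this
  rw [key, key]

/-! ### The pieces of the construction -/

/-- The part `|z| < r` of the domain of a local coordinate `z`. -/
def disc {X : Type*} [TopologicalSpace X] (z : OpenPartialHomeomorph X ℂ) (r : ℝ) : Set X :=
  {x | x ∈ z.source ∧ ‖z x‖ < r}

/-- The index set of the centres of a variation: one centre for each Schiffer index `j : J`, and
two centres (the left one `inr (inl f)`, the right one `inr (inr f)`) for each Fay index `f : F`. -/
abbrev Centre (J F : Type*) := J ⊕ (F ⊕ F)

/-- The centres `a i`, the local coordinates `z i` at them and the radius `δ` are admissible: each
`z i` is a holomorphic local coordinate at `a i` whose image contains the disc of radius `δ`, and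
the coordinate discs of radius `δ` are pairwise disjoint.  (This holds for all small `δ > 0`
as soon as the `a i` are finitely many distinct points of a Hausdorff space.) -/
structure Admissible {X : Type*} [TopologicalSpace X] [ChartedSpace ℂ X] {ι : Type*}
    (a : ι → X) (z : ι → OpenPartialHomeomorph X ℂ) (δ : ℝ) : Prop where
  pos : 0 < δ
  coord : ∀ i, z i ∈ IsManifold.maximalAtlas 𝓘(ℂ, ℂ) ω X
  mem_source : ∀ i, a i ∈ (z i).source
  map_centre : ∀ i, z i (a i) = 0
  ball_subset : ∀ i, Metric.ball 0 δ ⊆ (z i).target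
  disjoint : ∀ i i', i ≠ i' → Disjoint (disc (z i) δ) (disc (z i') δ)

section Pieces
set_option linter.unusedSectionVars false

variable {X : Type*} [TopologicalSpace X] {J F : Type*}

/-- The manifold `𝒳⁰ ⊆ X × Δ`, where `Δ` is the disc of radius `δ ^ 2 / 4` with coordinate `t`:
the closed sets `|z| ≤ √|t|` at the Schiffer centres and the closed sets `|z| ≤ |t| / δ`
at the Fay centres are deleted. -/
def base (z : Centre J F → OpenPartialHomeomorph X ℂ) (δ : ℝ) : Set (X × ℂ) :=
  {p | ‖p.2‖ < δ ^ 2 / 4 ∧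
    (∀ j : J, ¬ (p.1 ∈ (z (.inl j)).source ∧ ‖z (.inl j) p.1‖ ≤ √‖p.2‖)) ∧
    (∀ k : F ⊕ F, ¬ (p.1 ∈ (z (.inr k)).source ∧ ‖z (.inr k) p.1‖ ≤ ‖p.2‖ / δ))}

/-- The neighbourhood `D(t)` of `0` in the `w`-plane bounded by the curve `Γ(t)`, the image of the
circle `|z| = δ - √|t|` under `w = z + t / z` (see `frontier_region`).  It consists
of the `w` such that both roots of `z ^ 2 - w z + t` have absolute value `< δ - √|t|`. -/
def region (δ : ℝ) (t : ℂ) : Set ℂ :=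
  {w | ∃ x y : ℂ, x + y = w ∧ x * y = t ∧ ‖x‖ < δ - √‖t‖ ∧ ‖y‖ < δ - √‖t‖}

theorem isOpen_setOf_mem_region {δ : ℝ} :
    IsOpen {p : ℂ × ℂ | p.1 ∈ region δ p.2} := by
  have hcont : Continuous (fun q : ℂ × ℂ => (q.1 + q.2, q.1 * q.2)) := by fun_prop
  have hproper : IsProperMap (fun q : ℂ × ℂ => (q.1 + q.2, q.1 * q.2)) := by
    rw [isProperMap_iff_tendsto_cocompact]
    refine ⟨hcont, ?_⟩
    rw [← Metric.cobounded_eq_cocompact, ← tendsto_norm_atTop_iff_cobounded]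
    have key : ∀ x y : ℂ, ‖x‖ - 1 ≤ ‖((x + y, x * y) : ℂ × ℂ)‖ := by
      intro x y
      set M := ‖((x + y, x * y) : ℂ × ℂ)‖
      have h1 : ‖x + y‖ ≤ M := norm_fst_le ((x + y, x * y) : ℂ × ℂ)
      have h2 : ‖x * y‖ ≤ M := norm_snd_le ((x + y, x * y) : ℂ × ℂ)
      have h3 : ‖x‖ ^ 2 ≤ M * ‖x‖ + M := by
        calc ‖x‖ ^ 2 = ‖(x + y) * x - x * y‖ := by rw [← norm_pow]; ring_nf
          _ ≤ ‖x + y‖ * ‖x‖ + ‖x * y‖ := (norm_sub_le _ _).trans (by rw [norm_mul])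
          _ ≤ M * ‖x‖ + M := by gcongr
      by_contra! hlt
      have hM : 0 ≤ M := norm_nonneg _
      nlinarith [norm_nonneg x]
    have key2 : ∀ q : ℂ × ℂ, ‖q‖ - 1 ≤ ‖((q.1 + q.2, q.1 * q.2) : ℂ × ℂ)‖ := by
      rintro ⟨x, y⟩
      rw [Prod.norm_def]
      rcases max_choice ‖x‖ ‖y‖ with hm | hm
      · simp only [hm]; exact key x y
      · simp only [hm]
        have := key y x
        rwa [add_comm y x, mul_comm y x] at this
    refine tendsto_atTop_mono key2 ?_
    exact tendsto_atTop_add_const_right _ _ tendsto_norm_cobounded_atTop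
  have hclosed : IsClosed {q : ℂ × ℂ | ¬ (‖q.1‖ < δ - √‖q.1 * q.2‖ ∧ ‖q.2‖ < δ - √‖q.1 * q.2‖)} := by
    rw [← isOpen_compl_iff]
    simp only [compl_ofPred, not_not]
    exact (isOpen_lt (by fun_prop) (by fun_prop)).and (isOpen_lt (by fun_prop) (by fun_prop))
  have := (hproper.isClosedMap _ hclosed).isOpen_compl
  convert this using 1
  ext ⟨w, t⟩
  simp only [region, mem_ofPred_eq, mem_compl_iff, mem_image, Prod.exists, Prod.mk.injEq, not_exists]
  constructor
  · rintro ⟨x, y, rfl, rfl, hx, hy⟩ x' y' ⟨hn, h1, h2⟩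
    apply hn
    have : (x' - x) * (x' - y) = 0 := by linear_combination x' * h1 - h2
    rcases mul_eq_zero.1 this with h | h
    · obtain rfl : x' = x := sub_eq_zero.1 h
      obtain rfl : y' = y := by linear_combination h1
      exact ⟨hx, hy⟩
    · obtain rfl : x' = y := sub_eq_zero.1 h
      obtain rfl : y' = x := by linear_combination h1
      rw [mul_comm]
      exact ⟨hy, hx⟩
  · intro H
    obtain ⟨s, hs⟩ := IsAlgClosed.exists_pow_nat_eq (w ^ 2 - 4 * t) (n := 2) (by norm_num)
    have h1 : (w + s) / 2 + (w - s) / 2 = w := by ring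
    have h2 : (w + s) / 2 * ((w - s) / 2) = t := by linear_combination -hs / 4
    have := H ((w + s) / 2) ((w - s) / 2)
    refine ⟨_, _, h1, h2, ?_⟩
    by_contra hc
    exact this ⟨by rwa [h2], h1, h2⟩

theorem isOpen_region {δ : ℝ} {t : ℂ} : IsOpen (region δ t) :=
  isOpen_setOf_mem_region.preimage (f := fun w : ℂ => (w, t)) (by fun_prop)

theorem add_div_mem_region {δ : ℝ} {z t : ℂ} (h₁ : √‖t‖ < ‖z‖) (h₂ : ‖z‖ < δ - √‖t‖) :
    z + t / z ∈ region δ t := by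
  have hz : 0 < ‖z‖ := (Real.sqrt_nonneg _).trans_lt h₁
  have hz0 : z ≠ 0 := norm_pos_iff.1 hz
  refine ⟨z, t / z, rfl, by field_simp, h₂, lt_trans ?_ h₂⟩
  rw [norm_div, div_lt_iff₀ hz]
  have := Real.mul_self_sqrt (norm_nonneg t)
  nlinarith [Real.sqrt_nonneg ‖t‖]

/-- The region `D(t)` is bounded by the curve `Γ(t)`. -/
theorem frontier_region {δ : ℝ} {t : ℂ} (hδ : 0 < δ) (ht : ‖t‖ < δ ^ 2 / 4) :
    frontier (region δ t) = (fun z : ℂ => z + t / z) '' {z | ‖z‖ = δ - √‖t‖} := by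
  set R := δ - √‖t‖ with hR
  have hs : √‖t‖ < δ / 2 := by
    rw [Real.sqrt_lt' (by positivity)]; nlinarith
  have hRt : ‖t‖ < R * R := by
    have := Real.mul_self_sqrt (norm_nonneg t)
    nlinarith [Real.sqrt_nonneg ‖t‖]
  have hR0 : 0 < R := by rw [hR]; linarith
  rw [isOpen_region.frontier_eq]
  ext w
  constructor
  · rintro ⟨hw, hn⟩
    have hcl : IsClosed ((fun q : ℂ × ℂ => q.1 + q.2) ''
        (Metric.closedBall 0 R ∩ {q : ℂ × ℂ | q.1 * q.2 = t})) := by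
      refine IsCompact.isClosed (IsCompact.image ?_ (by fun_prop))
      exact (isCompact_closedBall _ _).inter_right (isClosed_eq (by fun_prop) (by fun_prop))
    have hsub : region δ t ⊆ (fun q : ℂ × ℂ => q.1 + q.2) ''
        (Metric.closedBall 0 R ∩ {q : ℂ × ℂ | q.1 * q.2 = t}) := by
      rintro _ ⟨x, y, rfl, hxy, hx, hy⟩
      refine ⟨(x, y), ⟨?_, hxy⟩, rfl⟩
      rw [mem_closedBall_zero_iff, Prod.norm_def]
      exact max_le hx.le hy.le
    obtain ⟨⟨x, y⟩, ⟨hb, hxy⟩, rfl⟩ := closure_minimal hsub hcl hw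
    rw [mem_closedBall_zero_iff, Prod.norm_def, max_le_iff] at hb
    simp only [mem_ofPred_eq] at hb hxy
    by_cases hx : ‖x‖ = R
    · have : x ≠ 0 := norm_pos_iff.1 (hx ▸ hR0)
      refine ⟨x, hx, ?_⟩
      simp only; rw [← hxy]; field_simp
    · by_cases hy : ‖y‖ = R
      · have : y ≠ 0 := norm_pos_iff.1 (hy ▸ hR0)
        refine ⟨y, hy, ?_⟩
        simp only; rw [← hxy]; field_simp; ring
      · exact absurd ⟨x, y, rfl, hxy, lt_of_le_of_ne hb.1 hx, lt_of_le_of_ne hb.2 hy⟩ hn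
  · rintro ⟨z, hz, rfl⟩
    simp only [mem_ofPred_eq] at hz
    have hz0 : z ≠ 0 := norm_pos_iff.1 (hz ▸ hR0)
    constructor
    · have hcont : ContinuousWithinAt (fun r : ℝ => (r : ℂ) * z + t / ((r : ℂ) * z)) (Iio 1) 1 := by
        apply ContinuousAt.continuousWithinAt
        have : ((1 : ℝ) : ℂ) * z ≠ 0 := by simpa using hz0
        fun_prop (disch := assumption)
      have hev : ∀ᶠ r : ℝ in 𝓝[<] 1, (r : ℂ) * z + t / ((r : ℂ) * z) ∈ region δ t := by
        have h1 : ∀ᶠ r : ℝ in 𝓝[<] 1, √‖t‖ / R < r := by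
          refine nhdsWithin_le_nhds (lt_mem_nhds ?_)
          rw [div_lt_one hR0, hR]; linarith
        filter_upwards [h1, self_mem_nhdsWithin] with r hr hr1
        have hr0 : 0 ≤ r := le_trans (by positivity) hr.le
        apply add_div_mem_region
        · rw [norm_mul, hz, Complex.norm_real, Real.norm_of_nonneg hr0]
          rwa [div_lt_iff₀ hR0] at hr
        · rw [norm_mul, hz, Complex.norm_real, Real.norm_of_nonneg hr0]
          have : r < 1 := hr1
          nlinarith
      have h2 := mem_closure_of_tendsto hcont.tendsto hev
      simpa using h2
    · rintro ⟨x, y, h1, h2, hx, hy⟩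
      have : (z - x) * (z - y) = 0 := by
        have h3 : z * (t / z) = t := by field_simp
        linear_combination h2 - h3 - z * h1
      rcases mul_eq_zero.1 this with h | h
      · obtain rfl : z = x := sub_eq_zero.1 h
        exact hx.ne hz
      · obtain rfl : z = y := sub_eq_zero.1 h
        exact hy.ne hz

/-- The surface `V = ⋃ D(t)`, with coordinates `(w, t)`, glued in at a Schiffer centre. -/
def schifferPatch (δ : ℝ) : Set (ℂ × ℂ) := {p | ‖p.2‖ < δ ^ 2 / 4 ∧ p.1 ∈ region δ p.2}

/-- The surface `S`, with coordinates `(X, Y)` and projection `t = X Y`, glued in at a pair of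
Fay centres. -/
def fayPatch (δ : ℝ) : Set (ℂ × ℂ) := {p | ‖p.1‖ < δ ∧ ‖p.2‖ < δ ∧ ‖p.1 * p.2‖ < δ ^ 2 / 4}

/-- The disjoint union of all the pieces: `𝒳⁰`, one copy of `V` for each Schiffer centre, and one
copy of `S` for each pair of Fay centres. -/
abbrev Pieces (z : Centre J F → OpenPartialHomeomorph X ℂ) (δ : ℝ) :=
  base z δ ⊕ ((Σ _ : J, schifferPatch δ) ⊕ (Σ _ : F, fayPatch δ))

/-- The glueing maps `w = z + t / z` on `√|t| < |z| < δ - √|t|` at a Schiffer centre, and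
`X = z, Y = t / z` (left), `X = t / z, Y = z` (right) on `|z| < δ` at the two Fay centres
of a pair. -/
inductive Glue (z : Centre J F → OpenPartialHomeomorph X ℂ) (δ : ℝ) :
    Pieces z δ → Pieces z δ → Prop
  | schiffer (j : J) (p : base z δ) (v : schifferPatch δ)
      (hs : p.1.1 ∈ (z (.inl j)).source)
      (h₁ : √‖p.1.2‖ < ‖z (.inl j) p.1.1‖) (h₂ : ‖z (.inl j) p.1.1‖ < δ - √‖p.1.2‖)
      (hv : v.1 = (z (.inl j) p.1.1 + p.1.2 / z (.inl j) p.1.1, p.1.2)) :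
      Glue z δ (.inl p) (.inr (.inl ⟨j, v⟩))
  | left (f : F) (p : base z δ) (s : fayPatch δ)
      (hs : p.1.1 ∈ disc (z (.inr (.inl f))) δ)
      (hv : s.1 = (z (.inr (.inl f)) p.1.1, p.1.2 / z (.inr (.inl f)) p.1.1)) :
      Glue z δ (.inl p) (.inr (.inr ⟨f, s⟩))
  | right (f : F) (p : base z δ) (s : fayPatch δ)
      (hs : p.1.1 ∈ disc (z (.inr (.inr f))) δ)
      (hv : s.1 = (p.1.2 / z (.inr (.inr f)) p.1.1, z (.inr (.inr f)) p.1.1)) :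
      Glue z δ (.inl p) (.inr (.inr ⟨f, s⟩))

end Pieces

section Total

set_option linter.unusedSectionVars false

variable {X : Type*} [TopologicalSpace X] [ChartedSpace ℂ X] {J F : Type*}
  {a : Centre J F → X} {z : Centre J F → OpenPartialHomeomorph X ℂ} {δ : ℝ}

/-- The total space of the one-parameter variation of `X`, a complex surface over the disc `Δ` of
radius `δ ^ 2 / 4`: at every Schiffer centre a Schiffer variation is made and at every pair of Fay
centres a Fay variation, all with the same parameter `t`.
* `J = Unit`, `F = Empty`: the Schiffer variation centred at one point;
* `J = Empty`, `F = Unit`: the Fay variation (over `Δ`);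
* `J = Fin m`, `F = Unit`: the restriction of the Fay–Schiffer variation to the diagonal disc
  `t₁ = ⋯ = tₘ = tₘ₊₁ = t`. -/
def Total (_h : Admissible a z δ) : Type _ := Quot (Glue z δ)

variable (h : Admissible a z δ)

/-- The quotient map from the pieces to the total space. -/
def Total.mk (y : Pieces z δ) : Total h := Quot.mk _ y

instance : TopologicalSpace (Total h) := inferInstanceAs (TopologicalSpace (Quot (Glue z δ)))

/-- The parameter `t` on the pieces. -/
def Pieces.param : Pieces z δ → ℂ
  | .inl p => p.1.2
  | .inr (.inl v) => v.2.1.2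
  | .inr (.inr s) => s.2.1.1 * s.2.1.2

theorem coord_ne_zero (h : Admissible a z δ) (b : base z δ) (k : F ⊕ F)
    (hs : b.1.1 ∈ disc (z (.inr k)) δ) : z (.inr k) b.1.1 ≠ 0 := by
  have := b.2.2.2 k
  simp only [not_and, not_le] at this
  exact norm_pos_iff.1 ((div_nonneg (norm_nonneg _) h.pos.le).trans_lt (this hs.1))

/-- The projection of the total space to the disc `Δ`. -/
def proj (h : Admissible a z δ) : Total h → ℂ :=
  Quot.lift Pieces.param (by
    intro y y' hg
    cases hg with
    | schiffer j p v hs h₁ h₂ hv => simp only [Pieces.param, hv]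
    | left f p s hs hv =>
      have := coord_ne_zero h p _ hs
      simp only [Pieces.param, hv]; field_simp
    | right f p s hs hv =>
      have := coord_ne_zero h p _ hs
      simp only [Pieces.param, hv]; field_simp)

/-- The fibre of the variation over `t`. -/
def Fibre (h : Admissible a z δ) (t : ℂ) : Type _ := {m : Total h // proj h m = t}

/-- The map of fibres over `t` given by a map over `Δ` of total spaces of variations. -/
def fibreMap {X' : Type*} [TopologicalSpace X'] [ChartedSpace ℂ X'] {J' F' : Type*}
    {a' : Centre J' F' → X'} {z' : Centre J' F' → OpenPartialHomeomorph X' ℂ}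
    {h : Admissible a z δ} {h' : Admissible a' z' δ} (H : Total h → Total h')
    (hH : ∀ m, proj h' (H m) = proj h m) (t : ℂ) : Fibre h t → Fibre h' t :=
  fun m => ⟨H m.1, (hH m.1).trans m.2⟩

/-! ### The complex structure of the total space -/

/-- The parametrizations by open subsets of `ℂ × ℂ`: `Rep α p y` says that `p` is in the domain of
the parametrization `α`, which sends it to `y`.  There is one parametrization of (a part of)
`𝒳⁰` for each preferred chart of `X`; the surfaces `V` and `S` are parametrized by themselves. -/
inductive Rep (z : Centre J F → OpenPartialHomeomorph X ℂ) (δ : ℝ) :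
    X ⊕ (J ⊕ F) → ℂ × ℂ → Pieces z δ → Prop
  | base (x : X) (p : ℂ × ℂ) (b : base z δ) (hp : p.1 ∈ (chartAt ℂ x).target)
      (hb : b.1 = ((chartAt ℂ x).symm p.1, p.2)) : Rep z δ (.inl x) p (.inl b)
  | schiffer (j : J) (p : ℂ × ℂ) (v : schifferPatch δ) (hv : v.1 = p) :
      Rep z δ (.inr (.inl j)) p (.inr (.inl ⟨j, v⟩))
  | fay (f : F) (p : ℂ × ℂ) (s : fayPatch δ) (hs : s.1 = p) :
      Rep z δ (.inr (.inr f)) p (.inr (.inr ⟨f, s⟩))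

theorem isOpen_schifferPatch : IsOpen (schifferPatch δ) :=
  (isOpen_lt (by fun_prop) (by fun_prop)).and isOpen_setOf_mem_region

theorem isOpen_fayPatch : IsOpen (fayPatch δ) :=
  (isOpen_lt (by fun_prop) (by fun_prop)).and
    ((isOpen_lt (by fun_prop) (by fun_prop)).and (isOpen_lt (by fun_prop) (by fun_prop)))

theorem sqrt_lt (h : Admissible a z δ) {t : ℂ} (ht : ‖t‖ < δ ^ 2 / 4) : √‖t‖ < δ / 2 := by
  have := h.pos
  rw [Real.sqrt_lt' (by positivity)]; nlinarith

theorem div_lt (h : Admissible a z δ) {t : ℂ} (ht : ‖t‖ < δ ^ 2 / 4) : ‖t‖ / δ < δ / 2 := by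
  have := h.pos
  rw [div_lt_iff₀ this]; nlinarith

theorem isOpen_removed (h : Admissible a z δ) [T2Space X] (i : Centre J F) (r : ℂ → ℝ) (hr : Continuous r)
    (hb : ∀ t, ‖t‖ < δ ^ 2 / 4 → r t ≤ δ / 2) :
    IsOpen {p : X × ℂ | ‖p.2‖ < δ ^ 2 / 4 ∧ ¬ (p.1 ∈ (z i).source ∧ ‖z i p.1‖ ≤ r p.2)} := by
  have hδ := h.pos
  set K : Set X := (z i).symm '' Metric.closedBall 0 (δ / 2)
  have hsub : Metric.closedBall (0 : ℂ) (δ / 2) ⊆ (z i).target :=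
    (Metric.closedBall_subset_ball (by linarith)).trans (h.ball_subset i)
  have hK : IsClosed K :=
    ((isCompact_closedBall _ _).image_of_continuousOn ((z i).continuousOn_symm.mono hsub)).isClosed
  have h1 : IsOpen {p : X × ℂ | ‖p.2‖ < δ ^ 2 / 4} := isOpen_lt (by fun_prop) (by fun_prop)
  have h2 : IsOpen (Prod.fst ⁻¹' Kᶜ : Set (X × ℂ)) := hK.isOpen_compl.preimage continuous_fst
  have h3 : IsOpen ((Prod.fst ⁻¹' (z i).source : Set (X × ℂ)) ∩
      {p : X × ℂ | r p.2 - ‖z i p.1‖ ∈ Iio (0 : ℝ)}) := by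
    refine ContinuousOn.isOpen_inter_preimage ?_ ((z i).open_source.preimage continuous_fst)
      isOpen_Iio
    refine ContinuousOn.sub (by fun_prop) (ContinuousOn.norm ?_)
    exact (z i).continuousOn.comp continuous_fst.continuousOn fun _ hp => hp
  convert h1.inter (h2.union h3) using 1
  ext ⟨x, t⟩
  simp only [mem_ofPred_eq, mem_inter_iff, mem_union, mem_preimage, mem_compl_iff, mem_Iio, sub_neg]
  refine and_congr_right fun ht => ⟨fun hn => ?_, ?_⟩
  · by_cases hx : x ∈ (z i).source
    · right
      exact ⟨hx, not_le.1 fun hle => hn ⟨hx, hle⟩⟩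
    · left
      rintro ⟨u, hu, rfl⟩
      exact hx ((z i).map_target (hsub hu))
  · rintro (hn | hn) ⟨hx, hle⟩
    · refine hn ⟨z i x, ?_, (z i).left_inv hx⟩
      rw [mem_closedBall_zero_iff]
      exact hle.trans (hb t ht)
    · exact absurd hle (not_le.2 hn.2)

theorem isOpen_base (h : Admissible a z δ) [T2Space X] [Finite J] [Finite F] : IsOpen (base z δ) := by
  have h1 : IsOpen {p : X × ℂ | ‖p.2‖ < δ ^ 2 / 4} := isOpen_lt (by fun_prop) (by fun_prop)
  have h2 := isOpen_iInter_of_finite fun j : J =>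
    isOpen_removed h (.inl j) (fun t => √‖t‖) (by fun_prop) fun t ht => (sqrt_lt h ht).le
  have h3 := isOpen_iInter_of_finite fun k : F ⊕ F =>
    isOpen_removed h (.inr k) (fun t => ‖t‖ / δ) (by fun_prop) fun t ht => (div_lt h ht).le
  convert h1.inter (h2.inter h3) using 1
  ext p
  simp only [base, mem_ofPred_eq, mem_inter_iff, mem_iInter]
  grind

theorem Rep.unique {α : X ⊕ (J ⊕ F)} {p : ℂ × ℂ} {y y' : Pieces z δ} (hy : Rep z δ α p y)
    (hy' : Rep z δ α p y') : y = y' := by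
  cases hy <;> cases hy' <;> grind

theorem exists_rep (y : Pieces z δ) : ∃ α p, Rep z δ α p y := by
  rcases y with b | ⟨j, v⟩ | ⟨f, s⟩
  · refine ⟨_, (chartAt ℂ b.1.1 b.1.1, b.1.2), .base b.1.1 _ b (mem_chart_target _ _) ?_⟩
    ext <;> simp
  · exact ⟨_, _, .schiffer j _ v rfl⟩
  · exact ⟨_, _, .fay f _ s rfl⟩

theorem isOpen_dom (h : Admissible a z δ) [T2Space X] [Finite J] [Finite F] (α : X ⊕ (J ⊕ F)) :
    IsOpen {p | ∃ y, Rep z δ α p y} := by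
  rcases α with x | j | f
  · have : {p | ∃ y, Rep z δ (.inl x) p y} = (Prod.fst ⁻¹' (chartAt ℂ x).target) ∩
        (fun p : ℂ × ℂ => ((chartAt ℂ x).symm p.1, p.2)) ⁻¹' base z δ := by
      ext p
      constructor
      · rintro ⟨y, hy⟩
        cases hy with
        | base _ _ b hp hb => exact ⟨hp, by rw [mem_preimage, ← hb]; exact b.2⟩
      · rintro ⟨hp, hb⟩
        exact ⟨_, .base x p ⟨_, hb⟩ hp rfl⟩
    rw [this]
    refine ContinuousOn.isOpen_inter_preimage ?_
      ((chartAt ℂ x).open_target.preimage continuous_fst) (isOpen_base h)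
    refine ContinuousOn.prodMk ?_ (by fun_prop)
    exact (chartAt ℂ x).continuousOn_symm.comp continuous_fst.continuousOn fun _ hp => hp
  · convert isOpen_schifferPatch (δ := δ) using 1
    ext p
    constructor
    · rintro ⟨y, hy⟩
      cases hy with
      | schiffer _ _ v hv => exact hv ▸ v.2
    · exact fun hp => ⟨_, .schiffer j p ⟨p, hp⟩ rfl⟩
  · convert isOpen_fayPatch (δ := δ) using 1
    ext p
    constructor
    · rintro ⟨y, hy⟩
      cases hy with
      | fay _ _ v hv => exact hv ▸ v.2
    · exact fun hp => ⟨_, .fay f p ⟨p, hp⟩ rfl⟩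

/-- Near `p`, the parametrization `α` is obtained from the parametrization `β` near `p'` by a
holomorphic change of coordinates. -/
def Trans (h : Admissible a z δ) (α : X ⊕ (J ⊕ F)) (p : ℂ × ℂ) (β : X ⊕ (J ⊕ F)) (p' : ℂ × ℂ) :
    Prop :=
  ∃ φ : ℂ × ℂ → ℂ × ℂ, ContDiffAt ℂ ω φ p ∧ φ p = p' ∧ ∀ᶠ q in 𝓝 p,
    ∃ y y', Rep z δ α q y ∧ Rep z δ β (φ q) y' ∧ Total.mk h y = Total.mk h y'

theorem Trans.trans {α β γ : X ⊕ (J ⊕ F)} {p p' p'' : ℂ × ℂ} (h₁ : Trans h α p β p')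
    (h₂ : Trans h β p' γ p'') : Trans h α p γ p'' := by
  obtain ⟨φ, hφ, rfl, h1⟩ := h₁
  obtain ⟨ψ, hψ, rfl, h2⟩ := h₂
  refine ⟨ψ ∘ φ, hψ.comp p hφ, rfl, ?_⟩
  filter_upwards [h1, hφ.continuousAt.eventually h2] with q ⟨y, y', hy, hy', e⟩ ⟨w, w', hw, hw', e'⟩
  obtain rfl := hy'.unique hw
  exact ⟨y, w', hy, hw', e.trans e'⟩

theorem contDiffAt_coord {c c' : OpenPartialHomeomorph X ℂ}
    (hc : c ∈ IsManifold.maximalAtlas 𝓘(ℂ, ℂ) ω X) (hc' : c' ∈ IsManifold.maximalAtlas 𝓘(ℂ, ℂ) ω X)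
    {u : ℂ} (hu : u ∈ c.target) (hu' : c.symm u ∈ c'.source) :
    ContDiffAt ℂ ω (fun v => c' (c.symm v)) u := by
  rw [← contMDiffAt_iff_contDiffAt]
  exact (contMDiffAt_of_mem_maximalAtlas hc' hu').comp u (contMDiffAt_symm_of_mem_maximalAtlas hc hu)

theorem contDiffAt_left [IsManifold 𝓘(ℂ, ℂ) ω X] (h : Admissible a z δ) (x : X) (i : Centre J F) {p : ℂ × ℂ}
    (hp : p.1 ∈ (chartAt ℂ x).target) (hs : (chartAt ℂ x).symm p.1 ∈ (z i).source) :
    ContDiffAt ℂ ω (fun q : ℂ × ℂ => z i ((chartAt ℂ x).symm q.1)) p :=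
  (contDiffAt_coord (IsManifold.chart_mem_maximalAtlas x) (h.coord i) hp hs).comp p contDiffAt_fst

theorem contDiffAt_right [IsManifold 𝓘(ℂ, ℂ) ω X] (h : Admissible a z δ) (x : X) (i : Centre J F) {u : ℂ}
    (hu : u ∈ (z i).target) (hs : (z i).symm u ∈ (chartAt ℂ x).source) :
    ContDiffAt ℂ ω (fun v : ℂ => chartAt ℂ x ((z i).symm v)) u :=
  contDiffAt_coord (h.coord i) (IsManifold.chart_mem_maximalAtlas x) hu hs

theorem eventually_source (x : X) (i : Centre J F) {p : ℂ × ℂ}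
    (hp : p.1 ∈ (chartAt ℂ x).target) (hs : (chartAt ℂ x).symm p.1 ∈ (z i).source) :
    ∀ᶠ q : ℂ × ℂ in 𝓝 p, (chartAt ℂ x).symm q.1 ∈ (z i).source := by
  have hc : ContinuousAt (fun q : ℂ × ℂ => (chartAt ℂ x).symm q.1) p :=
    ((chartAt ℂ x).continuousAt_symm hp).comp continuousAt_fst
  exact hc.eventually ((z i).open_source.mem_nhds hs)

/-- A holomorphic function `ζ` of `(w, t)` near `(u + t₀ / u, t₀)` with `ζ + t / ζ = w`. -/
theorem exists_root {u t₀ : ℂ} (hu : √‖t₀‖ < ‖u‖) :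
    ∃ ζ : ℂ × ℂ → ℂ, ContDiffAt ℂ ω ζ (u + t₀ / u, t₀) ∧ ζ (u + t₀ / u, t₀) = u ∧
      ∀ᶠ q in 𝓝 ((u + t₀ / u, t₀) : ℂ × ℂ), ζ q + q.2 / ζ q = q.1 := by
  have hu0 : u ≠ 0 := norm_pos_iff.1 ((Real.sqrt_nonneg _).trans_lt hu)
  have hs0 : u - t₀ / u ≠ 0 := by
    intro hz
    have h1 : u * u = t₀ := by field_simp at hz; linear_combination hz
    rw [← h1, norm_mul, Real.sqrt_mul_self (norm_nonneg _)] at hu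
    exact lt_irrefl _ hu
  set s₀ := u - t₀ / u with hs₀
  set p : ℂ × ℂ := (u + t₀ / u, t₀) with hp
  have hval : (p.1 ^ 2 - 4 * p.2) / s₀ ^ 2 = 1 := by
    rw [div_eq_one_iff_eq (pow_ne_zero 2 hs0), hs₀, hp]
    field_simp
    ring
  have hq : ContDiffAt ℂ ω (fun q : ℂ × ℂ => (q.1 ^ 2 - 4 * q.2) / s₀ ^ 2) p := by
    refine ContDiffAt.div_const ?_ _
    exact (contDiffAt_fst.pow 2).sub (contDiffAt_const.mul contDiffAt_snd)
  have hlog : ContDiffAt ℂ ω (fun q : ℂ × ℂ => Complex.log ((q.1 ^ 2 - 4 * q.2) / s₀ ^ 2)) p :=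
    (Complex.contDiffAt_log (by rw [hval]; exact Complex.one_mem_slitPlane)).comp p hq
  set σ : ℂ × ℂ → ℂ := fun q => s₀ * Complex.exp (Complex.log ((q.1 ^ 2 - 4 * q.2) / s₀ ^ 2) / 2)
    with hσ
  have hζ : ContDiffAt ℂ ω (fun q : ℂ × ℂ => (q.1 + σ q) / 2) p :=
    (contDiffAt_fst.add (contDiffAt_const.mul (hlog.div_const 2).cexp)).div_const 2
  have hζp : (p.1 + σ p) / 2 = u := by
    have : σ p = s₀ := by
      rw [hσ]; simp only; rw [hval, Complex.log_one, zero_div, Complex.exp_zero, mul_one]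
    rw [this, hs₀, hp]
    ring
  refine ⟨_, hζ, hζp, ?_⟩
  have hne : ∀ᶠ q : ℂ × ℂ in 𝓝 p, (q.1 + σ q) / 2 ≠ 0 :=
    hζ.continuousAt.eventually_ne (by rw [hζp]; exact hu0)
  have hne' : ∀ᶠ q : ℂ × ℂ in 𝓝 p, (q.1 ^ 2 - 4 * q.2) / s₀ ^ 2 ≠ 0 :=
    hq.continuousAt.eventually_ne (by rw [hval]; exact one_ne_zero)
  filter_upwards [hne, hne'] with q h1 h2
  have h3 : σ q ^ 2 = q.1 ^ 2 - 4 * q.2 := by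
    rw [hσ]
    simp only
    rw [mul_pow, ← Complex.exp_nat_mul]
    push_cast
    rw [mul_div_cancel₀ _ (two_ne_zero), Complex.exp_log h2]
    field_simp
  rw [add_comm, ← eq_sub_iff_add_eq, div_eq_iff h1]
  linear_combination h3 / 4

section
variable [T2Space X] [Finite J] [Finite F]

/-- If the parametrizations `α` and `β` agree after a holomorphic change `φ`
of coordinates, they are related by `Trans`. -/
theorem trans_of_eventually (h : Admissible a z δ) {α β : X ⊕ (J ⊕ F)} {p p' : ℂ × ℂ} {y y' : Pieces z δ}
    (hy : Rep z δ α p y) (hy' : Rep z δ β p' y') (φ : ℂ × ℂ → ℂ × ℂ) (hφ : ContDiffAt ℂ ω φ p)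
    (hp : φ p = p') (H : ∀ᶠ q in 𝓝 p, ∀ w w', Rep z δ α q w → Rep z δ β (φ q) w' →
      Total.mk h w = Total.mk h w') : Trans h α p β p' := by
  refine ⟨φ, hφ, hp, ?_⟩
  have h1 := (isOpen_dom h α).mem_nhds ⟨y, hy⟩
  have h2 := hφ.continuousAt.eventually ((isOpen_dom h β).mem_nhds (x := φ p) ⟨y', hp ▸ hy'⟩)
  filter_upwards [H, h1, h2] with q hq ⟨w, hw⟩ ⟨w', hw'⟩
  exact ⟨w, w', hw, hw', hq w w' hw hw'⟩

variable [IsManifold 𝓘(ℂ, ℂ) ω X]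

theorem trans_refl {α β : X ⊕ (J ⊕ F)} {p p' : ℂ × ℂ} {y : Pieces z δ}
    (hy : Rep z δ α p y) (hy' : Rep z δ β p' y) : Trans h α p β p' := by
  cases hy with
  | base x p b hp hb =>
    cases hy' with
    | base x' p' _ hp' hb' =>
      have e : (chartAt ℂ x).symm p.1 = (chartAt ℂ x').symm p'.1 ∧ p.2 = p'.2 := by
        rw [hb] at hb'; exact Prod.mk.inj hb'
      have hm : (chartAt ℂ x).symm p.1 ∈ (chartAt ℂ x').source :=
        e.1 ▸ (chartAt ℂ x').map_target hp'
      refine trans_of_eventually h (.base x p b hp hb) (.base x' p' b hp' hb')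
        (fun q => (chartAt ℂ x' ((chartAt ℂ x).symm q.1), q.2)) ?_ ?_ ?_
      · refine ContDiffAt.prodMk ?_ contDiffAt_snd
        exact (contDiffAt_coord (IsManifold.chart_mem_maximalAtlas x)
          (IsManifold.chart_mem_maximalAtlas x') hp hm).comp p contDiffAt_fst
      · ext
        · simp only [e.1]; exact (chartAt ℂ x').right_inv hp'
        · exact e.2
      · have hc : ContinuousAt (fun q : ℂ × ℂ => (chartAt ℂ x).symm q.1) p :=
          ((chartAt ℂ x).continuousAt_symm hp).comp continuousAt_fst
        filter_upwards [hc.eventually ((chartAt ℂ x').open_source.mem_nhds hm)]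
          with q hq w w' hw hw'
        cases hw with
        | base _ _ b₁ _ hb₁ =>
          cases hw' with
          | base _ _ b₂ _ hb₂ =>
            have : b₁ = b₂ := by
              ext1
              rw [hb₁, hb₂]
              simp only [(chartAt ℂ x').left_inv hq]
            rw [this]
  | schiffer j p v hv =>
    cases hy' with
    | schiffer _ p' _ hv' =>
      obtain rfl : p = p' := hv.symm.trans hv'
      refine trans_of_eventually h (.schiffer j p v hv) (.schiffer j p v hv) id contDiffAt_id rfl ?_
      exact Eventually.of_forall fun q w w' hw hw' => by rw [hw.unique hw']
  | fay f p v hv =>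
    cases hy' with
    | fay _ p' _ hv' =>
      obtain rfl : p = p' := hv.symm.trans hv'
      refine trans_of_eventually h (.fay f p v hv) (.fay f p v hv) id contDiffAt_id rfl ?_
      exact Eventually.of_forall fun q w w' hw hw' => by rw [hw.unique hw']

theorem trans_glue (h : Admissible a z δ) {y y' : Pieces z δ} (hg : Glue z δ y y')
    {α β : X ⊕ (J ⊕ F)} {p p' : ℂ × ℂ} (hy : Rep z δ α p y) (hy' : Rep z δ β p' y') :
    Trans h α p β p' := by
  cases hg with
  | schiffer j b v hs h₁ h₂ hv =>
    cases hy with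
    | base x p b hp hb =>
    cases hy' with
    | schiffer _ p' _ hv' =>
    simp only [hb] at hs h₁ h₂ hv
    have hne : z (.inl j) ((chartAt ℂ x).symm p.1) ≠ 0 :=
      norm_pos_iff.1 ((Real.sqrt_nonneg _).trans_lt h₁)
    have hg := contDiffAt_left h x (.inl j) hp hs
    have e₁ : ∀ᶠ q : ℂ × ℂ in 𝓝 p, √‖q.2‖ < ‖z (.inl j) ((chartAt ℂ x).symm q.1)‖ :=
      ContinuousAt.eventually_lt (by fun_prop) hg.continuousAt.norm h₁
    have e₂ : ∀ᶠ q : ℂ × ℂ in 𝓝 p, ‖z (.inl j) ((chartAt ℂ x).symm q.1)‖ < δ - √‖q.2‖ :=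
      ContinuousAt.eventually_lt hg.continuousAt.norm (by fun_prop) h₂
    refine trans_of_eventually h (.base x p b hp hb) (.schiffer j p' v hv')
      (fun q => (z (.inl j) ((chartAt ℂ x).symm q.1) +
        q.2 / z (.inl j) ((chartAt ℂ x).symm q.1), q.2)) ?_ ?_ ?_
    · exact (hg.add (contDiffAt_snd.div hg hne)).prodMk contDiffAt_snd
    · rw [← hv', hv]
    · filter_upwards [e₁, e₂, eventually_source x (.inl j) hp hs] with q h1 h2 h3 w w' hw hw'
      cases hw with
      | base _ _ b' hp' hb' =>
      cases hw' with
      | schiffer _ _ v' hv'' =>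
      refine Quot.sound (.schiffer j b' v' ?_ ?_ ?_ ?_) <;> simp only [hb', hv''] <;> assumption
  | left f b s hs hv =>
    cases hy with
    | base x p b hp hb =>
    cases hy' with
    | fay _ p' _ hv' =>
    simp only [hb] at hs hv
    have hb2 := b.2.2.2 (.inl f)
    simp only [hb, not_and, not_le] at hb2
    have hne : z (.inr (.inl f)) ((chartAt ℂ x).symm p.1) ≠ 0 :=
      norm_pos_iff.1 ((div_nonneg (norm_nonneg _) h.pos.le).trans_lt (hb2 hs.1))
    have hg := contDiffAt_left h x (.inr (.inl f)) hp hs.1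
    have e₂ : ∀ᶠ q : ℂ × ℂ in 𝓝 p, ‖z (.inr (.inl f)) ((chartAt ℂ x).symm q.1)‖ < δ :=
      ContinuousAt.eventually_lt hg.continuousAt.norm (by fun_prop) hs.2
    refine trans_of_eventually h (.base x p b hp hb) (.fay f p' s hv')
      (fun q => (z (.inr (.inl f)) ((chartAt ℂ x).symm q.1),
        q.2 / z (.inr (.inl f)) ((chartAt ℂ x).symm q.1))) ?_ ?_ ?_
    · exact hg.prodMk (contDiffAt_snd.div hg hne)
    · rw [← hv', hv]
    · filter_upwards [e₂, eventually_source x (.inr (.inl f)) hp hs.1] with q h2 h3 w w' hw hw'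
      cases hw with
      | base _ _ b' hp' hb' =>
      cases hw' with
      | fay _ _ v' hv'' =>
      refine Quot.sound (.left f b' v' ⟨?_, ?_⟩ ?_) <;> simp only [hb', hv''] <;> assumption
  | right f b s hs hv =>
    cases hy with
    | base x p b hp hb =>
    cases hy' with
    | fay _ p' _ hv' =>
    simp only [hb] at hs hv
    have hb2 := b.2.2.2 (.inr f)
    simp only [hb, not_and, not_le] at hb2
    have hne : z (.inr (.inr f)) ((chartAt ℂ x).symm p.1) ≠ 0 :=
      norm_pos_iff.1 ((div_nonneg (norm_nonneg _) h.pos.le).trans_lt (hb2 hs.1))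
    have hg := contDiffAt_left h x (.inr (.inr f)) hp hs.1
    have e₂ : ∀ᶠ q : ℂ × ℂ in 𝓝 p, ‖z (.inr (.inr f)) ((chartAt ℂ x).symm q.1)‖ < δ :=
      ContinuousAt.eventually_lt hg.continuousAt.norm (by fun_prop) hs.2
    refine trans_of_eventually h (.base x p b hp hb) (.fay f p' s hv')
      (fun q => (q.2 / z (.inr (.inr f)) ((chartAt ℂ x).symm q.1),
        z (.inr (.inr f)) ((chartAt ℂ x).symm q.1))) ?_ ?_ ?_
    · exact (contDiffAt_snd.div hg hne).prodMk hg
    · rw [← hv', hv]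
    · filter_upwards [e₂, eventually_source x (.inr (.inr f)) hp hs.1] with q h2 h3 w w' hw hw'
      cases hw with
      | base _ _ b' hp' hb' =>
      cases hw' with
      | fay _ _ v' hv'' =>
      refine Quot.sound (.right f b' v' ⟨?_, ?_⟩ ?_) <;> simp only [hb', hv''] <;> assumption

theorem trans_glue_symm (h : Admissible a z δ) {y y' : Pieces z δ} (hg : Glue z δ y y')
    {α β : X ⊕ (J ⊕ F)} {p p' : ℂ × ℂ} (hy : Rep z δ α p y) (hy' : Rep z δ β p' y') :
    Trans h β p' α p := by
  -- the common part: recover the point of `𝒳⁰` from the local coordinate `ζ` as a function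
  -- on the other piece
  have main : ∀ (i : Centre J F) (x : X) (b : base z δ) (hp : p.1 ∈ (chartAt ℂ x).target)
      (hb : b.1 = ((chartAt ℂ x).symm p.1, p.2)) (hs : b.1.1 ∈ (z i).source)
      (ζ τ : ℂ × ℂ → ℂ) (hζ : ContDiffAt ℂ ω ζ p') (hζp : ζ p' = z i b.1.1)
      (hτ : ContDiffAt ℂ ω τ p') (hτp : τ p' = p.2)
      (H : ∀ᶠ q in 𝓝 p', ∀ (b' : base z δ) (w : Pieces z δ), Rep z δ β q w →
        b'.1.1 ∈ (z i).source → z i b'.1.1 = ζ q → b'.1.2 = τ q → Glue z δ (.inl b') w),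
      Trans h β p' (.inl x) p := by
    intro i x b hp hb hs ζ τ hζ hζp hτ hτp H
    have hb1 : b.1.1 = (chartAt ℂ x).symm p.1 := by rw [hb]
    have hsym : (z i).symm (ζ p') = (chartAt ℂ x).symm p.1 := by
      rw [hζp, (z i).left_inv hs, hb1]
    have htar : ζ p' ∈ (z i).target := hζp ▸ (z i).map_source hs
    have hsrc : (z i).symm (ζ p') ∈ (chartAt ℂ x).source :=
      hsym ▸ (chartAt ℂ x).map_target hp
    refine trans_of_eventually h hy' (.base x p b hp hb)
      (fun q => (chartAt ℂ x ((z i).symm (ζ q)), τ q)) ?_ ?_ ?_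
    · exact ((contDiffAt_right h x i htar hsrc).comp p' hζ).prodMk hτ
    · ext
      · simp only [hsym]; exact (chartAt ℂ x).right_inv hp
      · exact hτp
    · have e₁ := hζ.continuousAt.eventually ((z i).open_target.mem_nhds htar)
      have hc : ContinuousAt (fun q => (z i).symm (ζ q)) p' :=
        ContinuousAt.comp (g := (z i).symm) ((z i).continuousAt_symm htar) hζ.continuousAt
      have e₂ := hc.eventually ((chartAt ℂ x).open_source.mem_nhds hsrc)
      filter_upwards [H, e₁, e₂] with q hq h1 h2 w w' hw hw'
      cases hw' with
      | base _ _ b' hp' hb' =>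
      have hb'1 : b'.1.1 = (z i).symm (ζ q) := by
        rw [hb']; exact (chartAt ℂ x).left_inv h2
      refine (Quot.sound (hq b' w hw ?_ ?_ ?_)).symm
      · rw [hb'1]; exact (z i).map_target h1
      · rw [hb'1]; exact (z i).right_inv h1
      · rw [hb']
  cases hg with
  | schiffer j b v hs h₁ h₂ hv =>
    cases hy with
    | base x p b hp hb =>
    cases hy' with
    | schiffer _ p' _ hv' =>
    obtain rfl : p' = (z (.inl j) b.1.1 + b.1.2 / z (.inl j) b.1.1, b.1.2) := hv'.symm.trans hv
    obtain ⟨ζ, hζ, hζp, hev⟩ := exists_root h₁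
    refine main (.inl j) x b hp hb hs ζ Prod.snd hζ hζp contDiffAt_snd (by rw [hb]) ?_
    have e₁ : ∀ᶠ q : ℂ × ℂ in 𝓝 (z (.inl j) b.1.1 + b.1.2 / z (.inl j) b.1.1, b.1.2),
        √‖q.2‖ < ‖ζ q‖ :=
      ContinuousAt.eventually_lt (by fun_prop) hζ.continuousAt.norm (by rw [hζp]; exact h₁)
    have e₂ : ∀ᶠ q : ℂ × ℂ in 𝓝 (z (.inl j) b.1.1 + b.1.2 / z (.inl j) b.1.1, b.1.2),
        ‖ζ q‖ < δ - √‖q.2‖ :=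
      ContinuousAt.eventually_lt hζ.continuousAt.norm (by fun_prop) (by rw [hζp]; exact h₂)
    filter_upwards [hev, e₁, e₂] with q h0 h1 h2 b' w hw hs' hz' ht'
    cases hw with
    | schiffer _ _ v' hv'' =>
    refine .schiffer j b' v' hs' ?_ ?_ ?_
    · rwa [hz', ht']
    · rwa [hz', ht']
    · rw [hv'', hz', ht', h0]
  | left f b s hs hv =>
    cases hy with
    | base x p b hp hb =>
    cases hy' with
    | fay _ p' _ hv' =>
    have hb2 := b.2.2.2 (.inl f)
    simp only [not_and, not_le] at hb2
    have hne : z (.inr (.inl f)) b.1.1 ≠ 0 :=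
      norm_pos_iff.1 ((div_nonneg (norm_nonneg _) h.pos.le).trans_lt (hb2 hs.1))
    obtain rfl : p' = (z (.inr (.inl f)) b.1.1, b.1.2 / z (.inr (.inl f)) b.1.1) :=
      hv'.symm.trans hv
    refine main (.inr (.inl f)) x b hp hb hs.1 Prod.fst (fun q => q.1 * q.2) contDiffAt_fst rfl
      (contDiffAt_fst.mul contDiffAt_snd) (by simp only [hb] at hne ⊢; field_simp) ?_
    have e₁ : ∀ᶠ q : ℂ × ℂ in 𝓝 (z (.inr (.inl f)) b.1.1, b.1.2 / z (.inr (.inl f)) b.1.1),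
        q.1 ≠ 0 := continuousAt_fst.eventually_ne hne
    filter_upwards [e₁] with q h0 b' w hw hs' hz' ht'
    cases hw with
    | fay _ _ v' hv'' =>
    refine .left f b' v' ⟨hs', ?_⟩ ?_
    · rw [hz', ← hv'']; exact v'.2.1
    · rw [hv'', hz', ht']; ext <;> simp [h0]
  | right f b s hs hv =>
    cases hy with
    | base x p b hp hb =>
    cases hy' with
    | fay _ p' _ hv' =>
    have hb2 := b.2.2.2 (.inr f)
    simp only [not_and, not_le] at hb2
    have hne : z (.inr (.inr f)) b.1.1 ≠ 0 :=
      norm_pos_iff.1 ((div_nonneg (norm_nonneg _) h.pos.le).trans_lt (hb2 hs.1))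
    obtain rfl : p' = (b.1.2 / z (.inr (.inr f)) b.1.1, z (.inr (.inr f)) b.1.1) :=
      hv'.symm.trans hv
    refine main (.inr (.inr f)) x b hp hb hs.1 Prod.snd (fun q => q.1 * q.2) contDiffAt_snd rfl
      (contDiffAt_fst.mul contDiffAt_snd) (by simp only [hb] at hne ⊢; field_simp) ?_
    have e₁ : ∀ᶠ q : ℂ × ℂ in 𝓝 (b.1.2 / z (.inr (.inr f)) b.1.1, z (.inr (.inr f)) b.1.1),
        q.2 ≠ 0 := continuousAt_snd.eventually_ne hne
    filter_upwards [e₁] with q h0 b' w hw hs' hz' ht'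
    cases hw with
    | fay _ _ v' hv'' =>
    refine .right f b' v' ⟨hs', ?_⟩ ?_
    · rw [hz', ← hv'']; exact v'.2.2.1
    · rw [hv'', hz', ht']; ext <;> simp [h0]

/-- Any two parametrizations of the same point are related by a holomorphic change of
coordinates. -/
theorem trans_of_eq (h : Admissible a z δ) {y y' : Pieces z δ}
    (he : Total.mk h y = Total.mk h y') {α β : X ⊕ (J ⊕ F)} {p p' : ℂ × ℂ}
    (hy : Rep z δ α p y) (hy' : Rep z δ β p' y') : Trans h α p β p' := by
  have key : ∀ y y', Relation.EqvGen (Glue z δ) y y' → ∀ (α β : X ⊕ (J ⊕ F)) (p p' : ℂ × ℂ),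
      Rep z δ α p y → Rep z δ β p' y' → Trans h α p β p' ∧ Trans h β p' α p := by
    intro y y' he
    induction he with
    | rel y y' hg => exact fun α β p p' hy hy' => ⟨trans_glue h hg hy hy', trans_glue_symm h hg hy hy'⟩
    | refl y => exact fun α β p p' hy hy' => ⟨trans_refl h hy hy', trans_refl h hy' hy⟩
    | symm y y' _ ih => exact fun α β p p' hy hy' => (ih β α p' p hy' hy).symm
    | trans y y' y'' _ _ ih₁ ih₂ =>
      intro α γ p p'' hy hy''
      obtain ⟨β, p', hy'⟩ := exists_rep y'
      exact ⟨(ih₁ α β p p' hy hy').1.trans h (ih₂ β γ p' p'' hy' hy'').1,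
        (ih₂ β γ p' p'' hy' hy'').2.trans h (ih₁ α β p p' hy hy').2⟩
  exact (key y y' (Quot.eqvGen_exact he) α β p p' hy hy').1

end

/-! Local injectivity of the parametrizations, through invariants of the glueing relation. -/

/-- The glueing data of a point: which points of the patches it is glued to, and the
point itself if it is a point of `𝒳⁰` that is not glued to any patch. -/
def Key : Pieces z δ → (X × ℂ) ⊕ ((J × ℂ × ℂ) ⊕ (F × ℂ × ℂ)) → Prop
  | .inl b, .inl c => c = b.1 ∧ ∀ y, ¬ Glue z δ (.inl b) y
  | .inl b, .inr (.inl c) => ∃ v : schifferPatch δ, v.1 = c.2 ∧ Glue z δ (.inl b) (.inr (.inl ⟨c.1, v⟩))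
  | .inl b, .inr (.inr c) => ∃ s : fayPatch δ, s.1 = c.2 ∧ Glue z δ (.inl b) (.inr (.inr ⟨c.1, s⟩))
  | .inr (.inl v), .inr (.inl c) => (v.1, v.2.1) = c
  | .inr (.inr s), .inr (.inr c) => (s.1, s.2.1) = c
  | _, _ => False

theorem mem_disc {j : J} {b : base z δ} (hs : b.1.1 ∈ (z (.inl j)).source)
    (h₂ : ‖z (.inl j) b.1.1‖ < δ - √‖b.1.2‖) : b.1.1 ∈ disc (z (.inl j)) δ :=
  ⟨hs, h₂.trans_le (by linarith [Real.sqrt_nonneg ‖b.1.2‖])⟩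

/-- A point of `𝒳⁰` is glued to at most one point of the patches. -/
theorem glue_unique (h : Admissible a z δ) {y y₁ y₂ : Pieces z δ} (h₁ : Glue z δ y y₁)
    (h₂ : Glue z δ y y₂) : y₁ = y₂ := by
  have hd : ∀ (i i' : Centre J F) (x : X), x ∈ disc (z i) δ → x ∈ disc (z i') δ → i = i' := by
    intro i i' x hx hx'
    by_contra hne
    exact (Set.disjoint_left.1 (h.disjoint i i' hne)) hx hx'
  cases h₁ with
  | schiffer j b v hs h1 h2 hv =>
    cases h₂ with
    | schiffer j' b v' hs' h1' h2' hv' =>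
      obtain rfl : j = j' := by
        simpa using hd _ _ _ (mem_disc hs h2) (mem_disc hs' h2')
      rw [Subtype.ext (hv.trans hv'.symm)]
    | left f b s hs' hv' => simpa using hd _ _ _ (mem_disc hs h2) hs'
    | right f b s hs' hv' => simpa using hd _ _ _ (mem_disc hs h2) hs'
  | left f b s hs hv =>
    cases h₂ with
    | schiffer j' b v' hs' h1' h2' hv' => simpa using hd _ _ _ hs (mem_disc hs' h2')
    | left f' b s' hs' hv' =>
      obtain rfl : f = f' := by simpa using hd _ _ _ hs hs'
      rw [Subtype.ext (hv.trans hv'.symm)]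
    | right f' b s' hs' hv' => simpa using hd _ _ _ hs hs'
  | right f b s hs hv =>
    cases h₂ with
    | schiffer j' b v' hs' h1' h2' hv' => simpa using hd _ _ _ hs (mem_disc hs' h2')
    | left f' b s' hs' hv' => simpa using hd _ _ _ hs hs'
    | right f' b s' hs' hv' =>
      obtain rfl : f = f' := by simpa using hd _ _ _ hs hs'
      rw [Subtype.ext (hv.trans hv'.symm)]

theorem key_eq_of_glue (h : Admissible a z δ) {y y' : Pieces z δ} (hg : Glue z δ y y') :
    Key y = Key y' := by
  have hb : ∃ b, y = .inl b := by cases hg <;> exact ⟨_, rfl⟩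
  obtain ⟨b, rfl⟩ := hb
  funext c
  rcases y' with b' | ⟨j, v⟩ | ⟨f, s⟩
  · cases hg
  · rcases c with c | ⟨j', c⟩ | ⟨f', c⟩
    · simp only [Key, eq_iff_iff, iff_false]
      exact fun hc => hc.2 _ hg
    · simp only [Key, eq_iff_iff]
      constructor
      · rintro ⟨v', rfl, hg'⟩
        have := glue_unique h hg hg'
        grind
      · intro hc
        obtain ⟨rfl, rfl⟩ := Prod.mk.inj hc
        exact ⟨v, rfl, hg⟩
    · simp only [Key, eq_iff_iff, iff_false]
      rintro ⟨s, -, hg'⟩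
      simpa using glue_unique h hg hg'
  · rcases c with c | ⟨j', c⟩ | ⟨f', c⟩
    · simp only [Key, eq_iff_iff, iff_false]
      exact fun hc => hc.2 _ hg
    · simp only [Key, eq_iff_iff, iff_false]
      rintro ⟨s, -, hg'⟩
      simpa using glue_unique h hg hg'
    · simp only [Key, eq_iff_iff]
      constructor
      · rintro ⟨v', rfl, hg'⟩
        have := glue_unique h hg hg'
        grind
      · intro hc
        obtain ⟨rfl, rfl⟩ := Prod.mk.inj hc
        exact ⟨s, rfl, hg⟩

theorem key_eq (h : Admissible a z δ) {y y' : Pieces z δ} (he : Total.mk h y = Total.mk h y') :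
    Key y = Key y' := by
  have := Quot.eqvGen_exact he
  induction this with
  | rel _ _ hg => exact key_eq_of_glue h hg
  | refl _ => rfl
  | symm _ _ hr ih => exact (ih (Quot.eqvGen_sound hr)).symm
  | trans _ _ _ h₁ h₂ ih₁ ih₂ =>
    exact (ih₁ (Quot.eqvGen_sound h₁)).trans (ih₂ (Quot.eqvGen_sound h₂))

theorem schiffer_inj (h : Admissible a z δ) {v v' : Σ _ : J, schifferPatch δ}
    (he : Total.mk h (.inr (.inl v)) = Total.mk h (.inr (.inl v'))) : v = v' := by
  have := congrFun (key_eq h he) (.inr (.inl (v'.1, v'.2.1)))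
  simp only [Key, eq_iff_iff, iff_true] at this
  grind

theorem fay_inj (h : Admissible a z δ) {v v' : Σ _ : F, fayPatch δ}
    (he : Total.mk h (.inr (.inr v)) = Total.mk h (.inr (.inr v'))) : v = v' := by
  have := congrFun (key_eq h he) (.inr (.inr (v'.1, v'.2.1)))
  simp only [Key, eq_iff_iff, iff_true] at this
  grind

/-- Two points of `𝒳⁰` with the same image are equal, or are the points of the two annuli of a
pair of Fay centres with coordinates of product `t`. -/
theorem base_eq (h : Admissible a z δ) {b b' : base z δ}
    (he : Total.mk h (.inl b) = Total.mk h (.inl b')) : b = b' ∨ ∃ f : F,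
      (b.1.1 ∈ disc (z (.inr (.inl f))) δ ∧ b'.1.1 ∈ disc (z (.inr (.inr f))) δ ∧
        z (.inr (.inl f)) b.1.1 * z (.inr (.inr f)) b'.1.1 = b.1.2) ∨
      (b.1.1 ∈ disc (z (.inr (.inr f))) δ ∧ b'.1.1 ∈ disc (z (.inr (.inl f))) δ ∧
        z (.inr (.inr f)) b.1.1 * z (.inr (.inl f)) b'.1.1 = b.1.2) := by
  have hk := key_eq h he
  have hne : ∀ (b : base z δ) (k : F ⊕ F), b.1.1 ∈ disc (z (.inr k)) δ → z (.inr k) b.1.1 ≠ 0 := by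
    intro b k hs
    have := b.2.2.2 k
    simp only [not_and, not_le] at this
    exact norm_pos_iff.1 ((div_nonneg (norm_nonneg _) h.pos.le).trans_lt (this hs.1))
  by_cases hb : ∀ y, ¬ Glue z δ (.inl b) y
  · left
    have := congrFun hk (.inl b.1)
    simp only [Key, eq_iff_iff, true_and] at this
    exact Subtype.ext (this.1 hb).1
  · push Not at hb
    obtain ⟨y, hy⟩ := hb
    have hy' : Glue z δ (.inl b') y := by
      rcases y with y | ⟨j, v⟩ | ⟨f, s⟩
      · cases hy
      · have := congrFun hk (.inr (.inl (j, v.1)))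
        simp only [Key, eq_iff_iff] at this
        obtain ⟨v', hv, hg⟩ := this.1 ⟨v, rfl, hy⟩
        rwa [Subtype.ext hv] at hg
      · have := congrFun hk (.inr (.inr (f, s.1)))
        simp only [Key, eq_iff_iff] at this
        obtain ⟨v', hv, hg⟩ := this.1 ⟨s, rfl, hy⟩
        rwa [Subtype.ext hv] at hg
    cases hy with
    | schiffer j _ v hs h1 h2 hv =>
      cases hy' with
      | schiffer _ _ _ hs' h1' h2' hv' =>
      left
      have e := hv.symm.trans hv'
      obtain ⟨e1, e2⟩ := Prod.mk.inj e
      rw [← e2] at e1 h1' h2'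
      have hu : z (.inl j) b.1.1 ≠ 0 := norm_pos_iff.1 ((Real.sqrt_nonneg _).trans_lt h1)
      have hu' : z (.inl j) b'.1.1 ≠ 0 := norm_pos_iff.1 ((Real.sqrt_nonneg _).trans_lt h1')
      have h3 : (z (.inl j) b.1.1 - z (.inl j) b'.1.1) *
          (z (.inl j) b.1.1 * z (.inl j) b'.1.1 - b.1.2) = 0 := by
        field_simp at e1
        linear_combination e1
      have h4 : z (.inl j) b.1.1 * z (.inl j) b'.1.1 - b.1.2 ≠ 0 := by
        intro h0
        have h5 := congrArg norm (sub_eq_zero.1 h0)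
        rw [norm_mul] at h5
        have := Real.mul_self_sqrt (norm_nonneg b.1.2)
        have := mul_lt_mul'' h1 h1' (Real.sqrt_nonneg _) (Real.sqrt_nonneg _)
        linarith
      have h5 := sub_eq_zero.1 ((mul_eq_zero.1 h3).resolve_right h4)
      exact Subtype.ext (Prod.ext ((z (.inl j)).injOn hs hs' h5) e2)
    | left f _ s hs hv =>
      cases hy' with
      | left _ _ _ hs' hv' =>
        left
        obtain ⟨e1, e2⟩ := Prod.mk.inj (hv.symm.trans hv')
        have := hne b (.inl f) hs
        rw [← e1, div_left_inj' this] at e2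
        exact Subtype.ext (Prod.ext ((z _).injOn hs.1 hs'.1 e1) e2)
      | right _ _ _ hs' hv' =>
        right
        obtain ⟨e1, e2⟩ := Prod.mk.inj (hv.symm.trans hv')
        have := hne b (.inl f) hs
        refine ⟨f, .inl ⟨hs, hs', ?_⟩⟩
        rw [← e2]
        field_simp
    | right f _ s hs hv =>
      cases hy' with
      | left _ _ _ hs' hv' =>
        right
        obtain ⟨e1, e2⟩ := Prod.mk.inj (hv.symm.trans hv')
        have := hne b (.inr f) hs
        refine ⟨f, .inr ⟨hs, hs', ?_⟩⟩
        rw [← e1]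
        field_simp
      | right _ _ _ hs' hv' =>
        left
        obtain ⟨e1, e2⟩ := Prod.mk.inj (hv.symm.trans hv')
        have := hne b (.inr f) hs
        rw [← e2, div_left_inj' this] at e1
        exact Subtype.ext (Prod.ext ((z _).injOn hs.1 hs'.1 e2) e1)

section
variable [T2Space X] [Finite J] [Finite F]

theorem exists_injOn_nhds (h : Admissible a z δ) {α : X ⊕ (J ⊕ F)} {p : ℂ × ℂ} {y : Pieces z δ}
    (hy : Rep z δ α p y) : ∃ W : Set (ℂ × ℂ), IsOpen W ∧ p ∈ W ∧ ∀ q ∈ W, ∀ q' ∈ W, ∀ w w',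
      Rep z δ α q w → Rep z δ α q' w' → Total.mk h w = Total.mk h w' → q = q' := by
  cases hy with
  | base x p b hp hb =>
    -- it is enough to find a neighbourhood of the point where the second alternative of
    -- `base_eq` does not occur
    suffices H : ∃ N : Set X, IsOpen N ∧ b.1.1 ∈ N ∧ ∀ (f : F) (u u' : X) (t : ℂ), u ∈ N → u' ∈ N →
        ‖t‖ < δ ^ 2 / 4 → u ∈ disc (z (.inr (.inl f))) δ → u' ∈ disc (z (.inr (.inr f))) δ →
        z (.inr (.inl f)) u * z (.inr (.inr f)) u' ≠ t by
      obtain ⟨N, hN, hbN, hH⟩ := H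
      refine ⟨(Prod.fst ⁻¹' (chartAt ℂ x).target) ∩ ((fun q : ℂ × ℂ => (chartAt ℂ x).symm q.1) ⁻¹' N),
        ?_, ⟨hp, ?_⟩, ?_⟩
      · refine ContinuousOn.isOpen_inter_preimage ?_
          ((chartAt ℂ x).open_target.preimage continuous_fst) hN
        exact (chartAt ℂ x).continuousOn_symm.comp continuous_fst.continuousOn fun _ hp => hp
      · rw [hb] at hbN; exact hbN
      · rintro q ⟨hq, hqN⟩ q' ⟨hq', hqN'⟩ w w' hw hw' he
        cases hw with
        | base _ _ b₁ _ hb₁ =>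
        cases hw' with
        | base _ _ b₂ _ hb₂ =>
        have e1 : b₁.1.1 = (chartAt ℂ x).symm q.1 := by rw [hb₁]
        have e2 : b₂.1.1 = (chartAt ℂ x).symm q'.1 := by rw [hb₂]
        rcases base_eq h he with rfl | ⟨f, ⟨h1, h2, h3⟩ | ⟨h1, h2, h3⟩⟩
        · obtain ⟨e3, e4⟩ := Prod.mk.inj (hb₁.symm.trans hb₂)
          exact Prod.ext ((chartAt ℂ x).symm.injOn hq hq' e3) e4
        · exact absurd h3 (hH f _ _ _ (e1 ▸ hqN) (e2 ▸ hqN') b₁.2.1 h1 h2)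
        · rw [mul_comm] at h3
          exact absurd h3 (hH f _ _ _ (e2 ▸ hqN') (e1 ▸ hqN) b₁.2.1 h2 h1)
    by_cases hk : ∃ k : F ⊕ F, b.1.1 ∈ disc (z (.inr k)) δ
    · obtain ⟨k, hk⟩ := hk
      refine ⟨disc (z (.inr k)) δ, ?_, hk, ?_⟩
      · have := (z (.inr k)).continuousOn.norm.isOpen_inter_preimage (z (.inr k)).open_source
          (isOpen_Iio (a := δ))
        exact this
      · intro f u u' t hu hu' _ h1 h2
        have hd : ∀ (i i' : Centre J F) (x : X), x ∈ disc (z i) δ → x ∈ disc (z i') δ → i = i' := by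
          intro i i' x hx hx'
          by_contra hne
          exact (Set.disjoint_left.1 (h.disjoint i i' hne)) hx hx'
        have := (hd _ _ _ hu h1).symm.trans (hd _ _ _ hu' h2)
        simp at this
    · push Not at hk
      have hδ := h.pos
      have hopen := isOpen_iInter_of_finite fun k : F ⊕ F =>
        (isOpen_removed h (.inr k) (fun _ => δ / 2) continuous_const fun t ht => le_rfl).preimage
          (f := fun u : X => (u, (0 : ℂ))) (by fun_prop)
      refine ⟨_, hopen, ?_, ?_⟩
      · refine mem_iInter.2 fun k => ⟨by simp only [norm_zero]; positivity, ?_⟩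
        rintro ⟨h1, h2⟩
        exact hk k ⟨h1, h2.trans_lt (by linarith)⟩
      · intro f u u' t hu hu' ht h1 h2 h3
        have hu1 := (mem_iInter.1 hu (.inl f)).2
        have hu2 := (mem_iInter.1 hu' (.inr f)).2
        simp only [not_and, not_le] at hu1 hu2
        have := mul_lt_mul'' (hu1 h1.1) (hu2 h2.1) (by positivity) (by positivity)
        rw [← norm_mul, h3] at this
        nlinarith
  | schiffer j p v hv =>
    refine ⟨univ, isOpen_univ, trivial, fun q _ q' _ w w' hw hw' he => ?_⟩
    cases hw with
    | schiffer _ _ v₁ hv₁ =>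
    cases hw' with
    | schiffer _ _ v₂ hv₂ =>
    have := schiffer_inj h he
    grind
  | fay f p v hv =>
    refine ⟨univ, isOpen_univ, trivial, fun q _ q' _ w w' hw hw' he => ?_⟩
    cases hw with
    | fay _ _ v₁ hv₁ =>
    cases hw' with
    | fay _ _ v₂ hv₂ =>
    have := fay_inj h he
    grind

theorem Rep.eventually {α : X ⊕ (J ⊕ F)} {p : ℂ × ℂ} {y : Pieces z δ} (hy : Rep z δ α p y)
    {P : Pieces z δ → Prop} (H : ∀ᶠ q in 𝓝 p, ∀ w, Rep z δ α q w → P w) : ∀ᶠ w in 𝓝 y, P w := by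
  cases hy with
  | base x p b hp hb =>
    rw [nhds_inl, eventually_map]
    have hb1 : b.1.1 = (chartAt ℂ x).symm p.1 := by rw [hb]
    have hsrc : b.1.1 ∈ (chartAt ℂ x).source := hb1 ▸ (chartAt ℂ x).map_target hp
    have hc1 : ContinuousAt (fun b : FaySchiffer.base z δ => b.1.1) b := by fun_prop
    have hc : ContinuousAt (fun b : FaySchiffer.base z δ => (chartAt ℂ x b.1.1, b.1.2)) b :=
      (ContinuousAt.comp (g := chartAt ℂ x) (f := fun b : FaySchiffer.base z δ => b.1.1)
        ((chartAt ℂ x).continuousAt hsrc) hc1).prodMk (by fun_prop)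
    have he : (chartAt ℂ x b.1.1, b.1.2) = p := by
      ext
      · simp only [hb1]; exact (chartAt ℂ x).right_inv hp
      · simp only [hb]
    rw [ContinuousAt, he] at hc
    filter_upwards [hc.eventually H, hc1.eventually ((chartAt ℂ x).open_source.mem_nhds hsrc)]
      with b' hb' hs'
    exact hb' _ (.base x _ b' ((chartAt ℂ x).map_source hs')
      (Prod.ext ((chartAt ℂ x).left_inv hs').symm rfl))
  | schiffer j p v hv =>
    rw [nhds_inr, eventually_map, nhds_inl, eventually_map, Sigma.nhds_mk, eventually_map]
    have hc : ContinuousAt (fun v : schifferPatch δ => v.1) v := by fun_prop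
    rw [ContinuousAt, hv] at hc
    filter_upwards [hc.eventually H] with v' hv'
    exact hv' _ (.schiffer j _ v' rfl)
  | fay f p v hv =>
    rw [nhds_inr, eventually_map, nhds_inr, eventually_map, Sigma.nhds_mk, eventually_map]
    have hc : ContinuousAt (fun v : fayPatch δ => v.1) v := by fun_prop
    rw [ContinuousAt, hv] at hc
    filter_upwards [hc.eventually H] with v' hv'
    exact hv' _ (.fay f _ v' rfl)

theorem continuous_rep (α : X ⊕ (J ⊕ F)) (ρ : {p | ∃ y, Rep z δ α p y} → Pieces z δ)
    (hρ : ∀ q, Rep z δ α q.1 (ρ q)) : Continuous ρ := by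
  rcases α with x | j | f
  · have hmem : ∀ q : {p | ∃ y, Rep z δ (.inl x) p y}, q.1.1 ∈ (chartAt ℂ x).target ∧
        ((chartAt ℂ x).symm q.1.1, q.1.2) ∈ base z δ := by
      rintro ⟨q, w, hw⟩
      cases hw with
      | base _ _ b h1 h2 => exact ⟨h1, h2 ▸ b.2⟩
    have : ρ = fun q => .inl ⟨_, (hmem q).2⟩ :=
      funext fun q => (hρ q).unique (.base x q.1 ⟨_, (hmem q).2⟩ (hmem q).1 rfl)
    rw [this]
    refine continuous_inl.comp (Continuous.subtype_mk (Continuous.prodMk ?_ (by fun_prop)) _)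
    exact (chartAt ℂ x).continuousOn_symm.comp_continuous (by fun_prop) fun q => (hmem q).1
  · have hmem : ∀ q : {p | ∃ y, Rep z δ (.inr (.inl j)) p y}, q.1 ∈ schifferPatch δ := by
      rintro ⟨q, w, hw⟩
      cases hw with
      | schiffer _ _ v h1 => exact h1 ▸ v.2
    have : ρ = fun q => .inr (.inl ⟨j, ⟨_, hmem q⟩⟩) :=
      funext fun q => (hρ q).unique (.schiffer j q.1 ⟨_, hmem q⟩ rfl)
    rw [this]
    exact continuous_inr.comp (continuous_inl.comp (continuous_sigmaMk.comp
      (Continuous.subtype_mk (by fun_prop) _)))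
  · have hmem : ∀ q : {p | ∃ y, Rep z δ (.inr (.inr f)) p y}, q.1 ∈ fayPatch δ := by
      rintro ⟨q, w, hw⟩
      cases hw with
      | fay _ _ v h1 => exact h1 ▸ v.2
    have : ρ = fun q => .inr (.inr ⟨f, ⟨_, hmem q⟩⟩) :=
      funext fun q => (hρ q).unique (.fay f q.1 ⟨_, hmem q⟩ rfl)
    rw [this]
    exact continuous_inr.comp (continuous_inr.comp (continuous_sigmaMk.comp
      (Continuous.subtype_mk (by fun_prop) _)))

theorem Total.continuous_mk (h : Admissible a z δ) : Continuous (Total.mk h) := continuous_quot_mk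

variable [IsManifold 𝓘(ℂ, ℂ) ω X]

/-- The charts of the total space: the local inverses of the parametrizations. -/
def IsChart (h : Admissible a z δ) (c : OpenPartialHomeomorph (Total h) (ℂ × ℂ)) : Prop :=
  ∃ α, ∀ p ∈ c.target, ∃ y, Rep z δ α p y ∧ Total.mk h y = c.symm p

theorem exists_chart (h : Admissible a z δ) (m : Total h) :
    ∃ c : OpenPartialHomeomorph (Total h) (ℂ × ℂ), IsChart h c ∧ m ∈ c.source := by
  obtain ⟨y, rfl⟩ := Quot.exists_rep m
  obtain ⟨α, p, hy⟩ := exists_rep y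
  obtain ⟨W, hW, hpW, hinj⟩ := exists_injOn_nhds h hy
  classical
  set D : Set (ℂ × ℂ) := {p | ∃ y, Rep z δ α p y} with hD
  have hDo : IsOpen D := isOpen_dom h α
  set U : Set (ℂ × ℂ) := D ∩ W with hU
  have hUo : IsOpen U := hDo.inter hW
  let ψ : ℂ × ℂ → Total h := fun q => if hq : q ∈ D then Total.mk h hq.choose else Total.mk h y
  have hψ : ∀ q w, Rep z δ α q w → ψ q = Total.mk h w := by
    intro q w hw
    have hq : q ∈ D := ⟨w, hw⟩
    simp only [ψ, dif_pos hq]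
    rw [hq.choose_spec.unique hw]
  have hψinj : InjOn ψ U := by
    rintro q ⟨⟨w, hw⟩, hqW⟩ q' ⟨⟨w', hw'⟩, hqW'⟩ he
    rw [hψ q w hw, hψ q' w' hw'] at he
    exact hinj q hqW q' hqW' w w' hw hw' he
  have hψc : ContinuousOn ψ D := by
    rw [continuousOn_iff_continuous_domRestrict]
    have h1 : ∀ q : D, Rep z δ α q.1 q.2.choose := fun q => q.2.choose_spec
    have h2 : D.domRestrict ψ = fun q : D => Total.mk h q.2.choose :=
      funext fun q => hψ _ _ (h1 q)
    rw [h2]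
    exact (Total.continuous_mk h).comp (continuous_rep α (fun q : D => q.2.choose) h1)
  have hψo : ∀ U' ⊆ U, IsOpen U' → IsOpen (ψ '' U') := by
    intro U' hU' hU'o
    have : IsOpen (Total.mk h ⁻¹' (ψ '' U')) := by
      rw [isOpen_iff_mem_nhds]
      rintro w ⟨q, hq, hqw⟩
      obtain ⟨w', hw'⟩ := (hU' hq).1
      rw [hψ q w' hw'] at hqw
      obtain ⟨β, p', hw⟩ := exists_rep w
      obtain ⟨φ, hφ, rfl, hev⟩ := trans_of_eq h hqw.symm hw hw'
      refine hw.eventually ?_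
      filter_upwards [hev, hφ.continuousAt.eventually (hU'o.mem_nhds hq)] with q' hq' hm w₁ hw₁
      obtain ⟨y₁, y₂, hy₁, hy₂, e⟩ := hq'
      refine ⟨φ q', hm, ?_⟩
      rw [hψ _ _ hy₂, ← e, hy₁.unique hw₁]
    exact this
  have hro : IsOpenMap (U.domRestrict ψ) := by
    intro O hO
    have h1 : U.domRestrict ψ '' O = ψ '' (Subtype.val '' O) := by
      rw [image_image]; rfl
    rw [h1]
    exact hψo _ (by rintro _ ⟨o, _, rfl⟩; exact o.2) (hUo.isOpenMap_subtype_val _ hO)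
  let e : OpenPartialHomeomorph (ℂ × ℂ) (Total h) :=
    OpenPartialHomeomorph.ofContinuousOpenRestrict (hψinj.toPartialEquiv ψ U)
      (hψc.mono inter_subset_left) hro hUo
  refine ⟨e.symm, ⟨α, ?_⟩, ?_⟩
  · rintro q ⟨⟨w, hw⟩, _⟩
    exact ⟨w, hw, (hψ q w hw).symm⟩
  · exact ⟨p, ⟨⟨y, hy⟩, hpW⟩, hψ p y hy⟩

noncomputable instance (h : Admissible a z δ) : ChartedSpace (ℂ × ℂ) (Total h) where
  atlas := {c | IsChart h c}
  chartAt m := (exists_chart h m).choose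
  mem_chart_source m := (exists_chart h m).choose_spec.2
  chart_mem_atlas m := (exists_chart h m).choose_spec.1

instance (h : Admissible a z δ) : IsManifold 𝓘(ℂ, ℂ × ℂ) ω (Total h) := by
  refine isManifold_of_contDiffOn _ _ _ ?_
  rintro c c' ⟨α, hα⟩ ⟨β, hβ⟩
  simp only [mfld_simps]
  rintro p ⟨hp, hp'⟩
  apply ContDiffAt.contDiffWithinAt
  obtain ⟨y, hy, hyp⟩ := hα p hp
  obtain ⟨y', hy', hyp'⟩ := hβ (c' (c.symm p)) (c'.map_source hp')
  rw [c'.left_inv hp'] at hyp'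
  obtain ⟨φ, hφ, hφp, hev⟩ := trans_of_eq h (hyp.trans hyp'.symm) hy hy'
  refine hφ.congr_of_eventuallyEq ?_
  have h1 : φ p ∈ c'.target := hφp ▸ c'.map_source hp'
  filter_upwards [hev, c.open_target.mem_nhds hp,
    hφ.continuousAt.eventually (c'.open_target.mem_nhds h1)] with q ⟨w, w', hw, hw', e⟩ hq hq'
  obtain ⟨w₁, hw₁, e₁⟩ := hα q hq
  obtain ⟨w₂, hw₂, e₂⟩ := hβ (φ q) hq'
  have : c.symm q = c'.symm (φ q) := by
    rw [← e₁, ← e₂, hw₁.unique hw, hw₂.unique hw', e]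
  simp only [Function.comp_apply, this]
  exact c'.right_inv hq'

end

/-! ### The fibre over `0` -/

theorem mem_base_zero (h : Admissible a z δ) {x : X} (hx : ∀ i, x ≠ a i) :
    ((x, 0) : X × ℂ) ∈ base z δ := by
  have hδ := h.pos
  have key : ∀ i, x ∈ (z i).source → ¬ ‖z i x‖ ≤ 0 := fun i hs hle =>
    hx i ((z i).injOn hs (h.mem_source i) ((norm_le_zero_iff.1 hle).trans (h.map_centre i).symm))
  refine ⟨by simp only [norm_zero]; positivity, ?_, ?_⟩
  · rintro j ⟨hs, hle⟩
    exact key _ hs (by simpa using hle)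
  · rintro k ⟨hs, hle⟩
    exact key _ hs (by simpa using hle)

/-- The origin of the patch glued in at a centre: the point `w = 0`, `t = 0` of `V`, or
the node `X = Y = 0` of `S`. -/
def origin (h : Admissible a z δ) : Centre J F → Pieces z δ
  | .inl j => .inr (.inl ⟨j, ⟨(0, 0), by
      have := h.pos
      refine ⟨by simp only [norm_zero]; positivity, 0, 0, by simp, by simp, ?_, ?_⟩ <;> simpa⟩⟩)
  | .inr k => .inr (.inr ⟨k.elim id id, ⟨(0, 0), by
      have := h.pos
      refine ⟨by simpa, by simpa, by simp only [mul_zero, norm_zero]; positivity⟩⟩⟩)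

open Classical in
/-- The map from `X` to the total space whose image is the fibre over `0`: a point `x` that is
not a centre is sent to `(x, 0) ∈ 𝒳⁰`, and a centre to the origin of the patch
glued in there. -/
noncomputable def centralMap (h : Admissible a z δ) (x : X) : Total h :=
  if hx : ∃ i, x = a i then Total.mk h (origin h hx.choose)
  else Total.mk h (.inl ⟨(x, 0), mem_base_zero h fun i hi => hx ⟨i, hi⟩⟩)

theorem centre_mem_disc (h : Admissible a z δ) (i : Centre J F) : a i ∈ disc (z i) δ :=
  ⟨h.mem_source i, by rw [h.map_centre i, norm_zero]; exact h.pos⟩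

theorem eq_of_mem_disc (h : Admissible a z δ) {i i' : Centre J F} {x : X}
    (hx : x ∈ disc (z i) δ) (hx' : x ∈ disc (z i') δ) : i = i' := by
  by_contra hne
  exact (Set.disjoint_left.1 (h.disjoint i i' hne)) hx hx'

theorem centre_injective (h : Admissible a z δ) : Function.Injective a := fun i i' hi =>
  eq_of_mem_disc h (centre_mem_disc h i) (hi ▸ centre_mem_disc h i')

theorem centralMap_centre (h : Admissible a z δ) (i : Centre J F) :
    centralMap h (a i) = Total.mk h (origin h i) := by
  have hx : ∃ i', a i = a i' := ⟨i, rfl⟩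
  rw [centralMap, dif_pos hx, ← centre_injective h hx.choose_spec]

theorem centralMap_of_ne (h : Admissible a z δ) {x : X} (hx : ∀ i, x ≠ a i) :
    centralMap h x = Total.mk h (.inl ⟨(x, 0), mem_base_zero h hx⟩) := by
  rw [centralMap, dif_neg]
  rintro ⟨i, hi⟩
  exact hx i hi

theorem proj_centralMap (h : Admissible a z δ) (x : X) : proj h (centralMap h x) = 0 := by
  by_cases hx : ∃ i, x = a i
  · obtain ⟨i, rfl⟩ := hx
    rw [centralMap_centre]
    rcases i with j | k
    · rfl
    · exact mul_zero (0 : ℂ)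
  · push Not at hx
    rw [centralMap_of_ne h hx]
    rfl

theorem mk_inl_ne_origin (h : Admissible a z δ) (b : base z δ) (hb : b.1.2 = 0) (i : Centre J F) :
    Total.mk h (.inl b) ≠ Total.mk h (origin h i) := by
  intro he
  have hk := key_eq h he
  rcases i with j | k
  · have := congrFun hk (.inr (.inl (j, (0, 0))))
    simp only [Key, origin, eq_iff_iff, iff_true] at this
    obtain ⟨v, hv, hg⟩ := this
    cases hg with
    | schiffer _ _ _ hs h₁ h₂ hv' =>
    rw [hv, hb, zero_div, add_zero] at hv'
    have := (Prod.mk.inj hv').1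
    rw [← this, norm_zero] at h₁
    exact absurd h₁ (not_lt.2 (Real.sqrt_nonneg _))
  · have := congrFun hk (.inr (.inr (k.elim id id, (0, 0))))
    simp only [Key, origin, eq_iff_iff, iff_true] at this
    obtain ⟨v, hv, hg⟩ := this
    cases hg with
    | left f _ _ hs hv' =>
      rw [hv] at hv'
      exact coord_ne_zero h b _ hs (Prod.mk.inj hv').1.symm
    | right f _ _ hs hv' =>
      rw [hv] at hv'
      exact coord_ne_zero h b _ hs (Prod.mk.inj hv').2.symm

/-- Two points of `X` have the same image in the fibre over `0` if and only if they are equal or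
are the two centres of a Fay pair. -/
theorem centralMap_eq_iff (h : Admissible a z δ) {x x' : X} :
    centralMap h x = centralMap h x' ↔ x = x' ∨ ∃ f : F,
      (x = a (.inr (.inl f)) ∧ x' = a (.inr (.inr f))) ∨
      (x = a (.inr (.inr f)) ∧ x' = a (.inr (.inl f))) := by
  constructor
  · intro he
    by_cases hx : ∃ i, x = a i
    · obtain ⟨i, rfl⟩ := hx
      by_cases hx' : ∃ i, x' = a i
      · obtain ⟨i', rfl⟩ := hx'
        rw [centralMap_centre, centralMap_centre] at he
        rcases i with j | k <;> rcases i' with j' | k'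
        · left
          have := schiffer_inj h he
          grind
        · have := congrFun (key_eq h he) (.inr (.inl (j, (0, 0))))
          simp [Key, origin] at this
        · have := congrFun (key_eq h he) (.inr (.inl (j', (0, 0))))
          simp [Key, origin] at this
        · have := congrArg Sigma.fst (fay_inj h he)
          rcases k with f | f <;> rcases k' with f' | f' <;>
            (obtain rfl : f = f' := this)
          · exact .inl rfl
          · exact .inr ⟨f, .inl ⟨rfl, rfl⟩⟩
          · exact .inr ⟨f, .inr ⟨rfl, rfl⟩⟩
          · exact .inl rfl
      · push Not at hx'
        rw [centralMap_centre, centralMap_of_ne h hx'] at he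
        exact absurd he.symm (mk_inl_ne_origin h _ rfl i)
    · push Not at hx
      by_cases hx' : ∃ i, x' = a i
      · obtain ⟨i, rfl⟩ := hx'
        rw [centralMap_centre, centralMap_of_ne h hx] at he
        exact absurd he (mk_inl_ne_origin h _ rfl i)
      · push Not at hx'
        rw [centralMap_of_ne h hx, centralMap_of_ne h hx'] at he
        left
        rcases base_eq h he with e | ⟨f, ⟨h1, h2, h3⟩ | ⟨h1, h2, h3⟩⟩
        · exact congrArg (fun b : base z δ => b.1.1) e
        · exact absurd h3 (mul_ne_zero (coord_ne_zero h _ _ h1) (coord_ne_zero h _ _ h2))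
        · exact absurd h3 (mul_ne_zero (coord_ne_zero h _ _ h1) (coord_ne_zero h _ _ h2))
  · rintro (rfl | ⟨f, ⟨rfl, rfl⟩ | ⟨rfl, rfl⟩⟩)
    · rfl
    · rw [centralMap_centre, centralMap_centre]; rfl
    · rw [centralMap_centre, centralMap_centre]; rfl

theorem exists_centralMap_eq (h : Admissible a z δ) (m : Total h) (hm : proj h m = 0) :
    ∃ x, centralMap h x = m := by
  -- the point of the disc at the centre `i` with coordinate `u ≠ 0`
  have aux : ∀ (i : Centre J F) (u : ℂ), u ≠ 0 → ‖u‖ < δ →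
      ∃ b : base z δ, b.1.2 = 0 ∧ b.1.1 ∈ disc (z i) δ ∧ z i b.1.1 = u ∧
        centralMap h b.1.1 = Total.mk h (.inl b) := by
    intro i u hu hlt
    have htar : u ∈ (z i).target := h.ball_subset i (mem_ball_zero_iff.2 hlt)
    have hz : z i ((z i).symm u) = u := (z i).right_inv htar
    have hd : (z i).symm u ∈ disc (z i) δ := ⟨(z i).map_target htar, by rwa [hz]⟩
    have hne : ∀ i', (z i).symm u ≠ a i' := by
      intro i' he
      obtain rfl := eq_of_mem_disc h hd (he ▸ centre_mem_disc h i')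
      rw [he, h.map_centre] at hz
      exact hu hz.symm
    exact ⟨⟨_, mem_base_zero h hne⟩, rfl, hd, hz, centralMap_of_ne h hne⟩
  obtain ⟨y, rfl⟩ := Quot.exists_rep m
  rcases y with ⟨⟨x, t⟩, hb⟩ | ⟨j, ⟨⟨w, t⟩, hv⟩⟩ | ⟨f, ⟨⟨u, v⟩, hs⟩⟩
  · obtain rfl : t = 0 := hm
    have hne : ∀ i, x ≠ a i := by
      rintro (j | k) rfl
      · exact hb.2.1 j ⟨h.mem_source _, by simp [h.map_centre]⟩
      · exact hb.2.2 k ⟨h.mem_source _, by simp [h.map_centre]⟩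
    exact ⟨x, centralMap_of_ne h hne⟩
  · obtain rfl : t = 0 := hm
    have hw : ‖w‖ < δ := by
      obtain ⟨-, x, y, rfl, hxy, hx, hy⟩ := hv
      simp only [norm_zero, Real.sqrt_zero, sub_zero] at hxy hx hy
      rcases mul_eq_zero.1 hxy with rfl | rfl
      · simpa using hy
      · simpa using hx
    by_cases hw0 : w = 0
    · subst hw0
      exact ⟨a (.inl j), centralMap_centre h (.inl j)⟩
    · obtain ⟨b, h0, hd, hz, hc⟩ := aux (.inl j) w hw0 hw
      refine ⟨_, hc.trans (Quot.sound (.schiffer j b _ hd.1 ?_ ?_ ?_))⟩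
      · rw [h0, hz]; simpa using hw0
      · rw [h0, hz]; simpa using hw
      · rw [h0, hz]; simp
  · have huv : u * v = 0 := hm
    by_cases hu : u = 0
    · subst hu
      by_cases hv : v = 0
      · subst hv
        exact ⟨a (.inr (.inl f)), centralMap_centre h (.inr (.inl f))⟩
      · obtain ⟨b, h0, hd, hz, hc⟩ := aux (.inr (.inr f)) v hv hs.2.1
        refine ⟨_, hc.trans (Quot.sound (.right f b _ hd ?_))⟩
        rw [h0, hz]; simp
    · obtain rfl : v = 0 := (mul_eq_zero.1 huv).resolve_left hu
      obtain ⟨b, h0, hd, hz, hc⟩ := aux (.inr (.inl f)) u hu hs.1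
      refine ⟨_, hc.trans (Quot.sound (.left f b _ hd ?_))⟩
      rw [h0, hz]; simp

end Total

section Central

variable {X : Type*} [TopologicalSpace X] [ChartedSpace ℂ X] {J : Type*} {δ : ℝ}

/-- With no Fay pairs, the fibre over `0` is identified with `X`. -/
noncomputable def centralFibre {a : Centre J Empty → X}
    {z : Centre J Empty → OpenPartialHomeomorph X ℂ} (h : Admissible a z δ) : X ≃ Fibre h 0 :=
  Equiv.ofBijective (fun x => ⟨centralMap h x, proj_centralMap h x⟩) (by
    constructor
    · intro x x' he
      rcases (centralMap_eq_iff h).1 (congrArg Subtype.val he) with e | ⟨f, -⟩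
      · exact e
      · exact f.elim
    · rintro ⟨m, hm⟩
      obtain ⟨x, rfl⟩ := exists_centralMap_eq h m hm
      exact ⟨x, rfl⟩)

/-- With one Fay pair `(p, q)`, the fibre over `0` is identified with the nodal curve
`X/(p ∼ q)`. -/
noncomputable def centralFibreNodal {a : Centre J Unit → X}
    {z : Centre J Unit → OpenPartialHomeomorph X ℂ} (h : Admissible a z δ) :
    Nodal (a (.inr (.inl ()))) (a (.inr (.inr ()))) ≃ Fibre h 0 :=
  Equiv.ofBijective
    (Quot.lift (fun x => ⟨centralMap h x, proj_centralMap h x⟩) (by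
      intro x x' hx
      exact Subtype.ext ((centralMap_eq_iff h).2 (.inr ⟨(), .inl hx⟩)))) (by
    constructor
    · rintro ⟨x⟩ ⟨x'⟩ he
      rcases (centralMap_eq_iff h).1 (congrArg Subtype.val he) with rfl | ⟨⟨⟩, hx | hx⟩
      · rfl
      · exact Quot.sound hx
      · exact Eq.symm (Quot.sound ⟨hx.2, hx.1⟩)
    · rintro ⟨m, hm⟩
      obtain ⟨x, rfl⟩ := exists_centralMap_eq h m hm
      exact ⟨Quot.mk _ x, rfl⟩)

end Central

end FaySchiffer

/-! The idea is that the glueing function `w = z + t / z` is the sum `X + Y` of the two Fay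
coordinates `X = z`, `Y = t / z`. Since `z_j = z_e ∘ h`, the map `h` is the identity in the
coordinates at the centres. So `H` can be taken to be `h × id` away from the discs, the identity `V
→ V` at each Schiffer centre, and `(X, Y) ↦ (w, t) = (X + Y, X Y)` at the Fay pair. These
prescriptions agree on the overlaps: on either annulus of the Fay pair the point goes to `w = z + t
/ z`. For `t = 0` one of `X`, `Y` vanishes and `w` is the other one, so `H_0` is induced by `h`.

Over a point `w = x + y`, `t = x y` each of the `n - 2` Schiffer centres contributes one point, and
the Fay pair contributes the two orderings `(x, y)`, `(y, x)` of the roots of `u ^ 2 - w u + t`.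
These coincide only if `w ^ 2 = 4 t`. Over a point outside the disc at `e` the fibre is that of `h`.
Hence the degree is `n`.

The quotient is handled through a normal form: the `Code` of a point records its position outside
the discs, or its coordinates `(w, t)` or `(X, Y)` at a centre. By `code_injective` and
`exists_code_eq` the total space is in bijection with the valid codes, so `H` can be defined on
codes (`coverCode`), and its fibres counted there (`hasDegree_fibreMap`), without choosing
representatives.

Two points need more than formulas. The preimage of the disc at `e` has to be the union of the discs
at the centres for every admissible radius; `isAdapted` derives this from the degree. And `X + Y`
can leave `D(t)`, in which case the image lies in the part of `ℬ` coming from `B × Δ`; this is the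
main case distinction in `contMDiff_coverMap`. -/

namespace FaySchiffer

/-! ### Normal forms for the points of a total space. -/

section Code

set_option linter.unusedSectionVars false

variable {X : Type*} [TopologicalSpace X] [ChartedSpace ℂ X] {J F : Type*}
  {a : Centre J F → X} {z : Centre J F → OpenPartialHomeomorph X ℂ} {δ : ℝ}

/-- The codes of points of the total space: a point of `X × ℂ` outside the coordinate discs, the
coordinates `(w, t)` at a Schiffer centre, or the coordinates `(X, Y)` at a Fay pair. -/
abbrev Code (X J F : Type*) := (X × ℂ) ⊕ ((J × (ℂ × ℂ)) ⊕ (F × (ℂ × ℂ)))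

/-- The code of the point of parameter `t` with local coordinate `u` at a centre. -/
noncomputable def centreCode (X : Type*) {J F : Type*} (u t : ℂ) : Centre J F → Code X J F
  | .inl j => .inr (.inl (j, (u + t / u, t)))
  | .inr (.inl f) => .inr (.inr (f, (u, t / u)))
  | .inr (.inr f) => .inr (.inr (f, (t / u, u)))

open Classical in
/-- The code of a point of `X × ℂ`. -/
noncomputable def pointCode (z : Centre J F → OpenPartialHomeomorph X ℂ) (δ : ℝ) (p : X × ℂ) :
    Code X J F :=
  if hi : ∃ i, p.1 ∈ disc (z i) δ then centreCode X (z hi.choose p.1) p.2 hi.choose else .inl p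

theorem pointCode_of_mem (h : Admissible a z δ) {p : X × ℂ} {i : Centre J F}
    (hp : p.1 ∈ disc (z i) δ) : pointCode z δ p = centreCode X (z i p.1) p.2 i := by
  have hi : ∃ i, p.1 ∈ disc (z i) δ := ⟨i, hp⟩
  rw [pointCode, dif_pos hi, eq_of_mem_disc h hi.choose_spec hp]

theorem pointCode_of_notMem {p : X × ℂ} (hp : ∀ i, p.1 ∉ disc (z i) δ) :
    pointCode z δ p = .inl p := by
  rw [pointCode, dif_neg]
  rintro ⟨i, hi⟩
  exact hp i hi

/-- The code of a point of one of the pieces. -/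
noncomputable def Pieces.code : Pieces z δ → Code X J F
  | .inl b => pointCode z δ b.1
  | .inr (.inl v) => .inr (.inl (v.1, v.2.1))
  | .inr (.inr s) => .inr (.inr (s.1, s.2.1))

/-- The code of a point of the total space. -/
noncomputable def code (h : Admissible a z δ) : Total h → Code X J F :=
  Quot.lift Pieces.code (by
    intro y y' hg
    cases hg with
    | schiffer j p v hs h₁ h₂ hv =>
      simp only [Pieces.code, pointCode_of_mem h (mem_disc hs h₂), centreCode, hv]
    | left f p s hs hv => simp only [Pieces.code, pointCode_of_mem h hs, centreCode, hv]
    | right f p s hs hv => simp only [Pieces.code, pointCode_of_mem h hs, centreCode, hv])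

@[simp] theorem code_mk_inl (h : Admissible a z δ) (b : base z δ) :
    code h (Total.mk h (.inl b)) = pointCode z δ b.1 := rfl

@[simp] theorem code_mk_schiffer (h : Admissible a z δ) (v : Σ _ : J, schifferPatch δ) :
    code h (Total.mk h (.inr (.inl v))) = .inr (.inl (v.1, v.2.1)) := rfl

@[simp] theorem code_mk_fay (h : Admissible a z δ) (s : Σ _ : F, fayPatch δ) :
    code h (Total.mk h (.inr (.inr s))) = .inr (.inr (s.1, s.2.1)) := rfl

/-- This explains the radius `|t| / δ` of the disc deleted at a Fay centre: for every remaining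
point of the coordinate disc both `u` and `t / u` are less than `δ` in absolute value, so the point
is glued to `S`. -/
theorem norm_div_lt {t u : ℂ} (hδ : 0 < δ) (hu : ‖t‖ / δ < ‖u‖) : ‖t / u‖ < δ := by
  have hu0 : 0 < ‖u‖ := (div_nonneg (norm_nonneg _) hδ.le).trans_lt hu
  rw [norm_div, div_lt_iff₀ hu0]
  rwa [div_lt_iff₀ hδ, mul_comm] at hu

theorem norm_div_le_sqrt {t u : ℂ} (hu : √‖t‖ < ‖u‖) : ‖t / u‖ ≤ √‖t‖ := by
  have hu0 : 0 < ‖u‖ := (Real.sqrt_nonneg _).trans_lt hu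
  rw [norm_div, div_le_iff₀ hu0]
  nlinarith [Real.mul_self_sqrt (norm_nonneg t), Real.sqrt_nonneg ‖t‖]

/-- A point of `𝒳⁰` in the coordinate disc at a Fay centre lies in the patch `S`. -/
theorem exists_glue_fay (h : Admissible a z δ) (b : base z δ) (k : F ⊕ F)
    (hs : b.1.1 ∈ disc (z (.inr k)) δ) :
    ∃ s, Total.mk h (.inl b) = Total.mk h (.inr (.inr s)) := by
  have hne := coord_ne_zero h b k hs
  have hb := b.2.2.2 k
  simp only [not_and, not_le] at hb
  have hlt := norm_div_lt h.pos (hb hs.1)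
  rcases k with f | f
  · refine ⟨⟨f, ⟨(_, _), hs.2, hlt, ?_⟩⟩, Quot.sound (.left f b _ hs rfl)⟩
    exact (congrArg norm (mul_div_cancel₀ _ hne)).trans_lt b.2.1
  · refine ⟨⟨f, ⟨(_, _), hlt, hs.2, ?_⟩⟩, Quot.sound (.right f b _ hs rfl)⟩
    exact (congrArg norm (div_mul_cancel₀ _ hne)).trans_lt b.2.1

/-- The only other solution would have `u v = t`, while the bounds give `|u v| > |t|`. -/
theorem eq_of_add_div_eq {t u v : ℂ} (hu : √‖t‖ < ‖u‖) (hv : √‖t‖ < ‖v‖)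
    (he : u + t / u = v + t / v) : u = v := by
  have hu0 : u ≠ 0 := norm_pos_iff.1 ((Real.sqrt_nonneg _).trans_lt hu)
  have hv0 : v ≠ 0 := norm_pos_iff.1 ((Real.sqrt_nonneg _).trans_lt hv)
  have h3 : (u - v) * (u * v - t) = 0 := by
    field_simp at he
    linear_combination he
  refine sub_eq_zero.1 ((mul_eq_zero.1 h3).resolve_right fun h0 => ?_)
  have h5 := congrArg norm (sub_eq_zero.1 h0)
  rw [norm_mul] at h5
  have := Real.mul_self_sqrt (norm_nonneg t)
  have := mul_lt_mul'' hu hv (Real.sqrt_nonneg _) (Real.sqrt_nonneg _)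
  linarith

/-- If `u` is the larger root of `u ^ 2 - w u + t` and `w ∈ D(t)`, then `|u| < δ - √|t|`. -/
theorem norm_lt_of_add_div_mem_region {t u : ℂ} (hu0 : u ≠ 0)
    (hw : u + t / u ∈ region δ t) : ‖u‖ < δ - √‖t‖ := by
  obtain ⟨x, y, h1, h2, hx, hy⟩ := hw
  have h3 : (u - x) * (u - y) = 0 := by
    have : u * (t / u) = t := by field_simp
    linear_combination h2 - this - u * h1
  rcases mul_eq_zero.1 h3 with h | h
  · rwa [sub_eq_zero.1 h]
  · rwa [sub_eq_zero.1 h]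

theorem sqrt_lt_coord (b : base z δ) (j : J) (hs : b.1.1 ∈ disc (z (.inl j)) δ) :
    √‖b.1.2‖ < ‖z (.inl j) b.1.1‖ := by
  have := b.2.2.1 j
  simp only [not_and, not_le] at this
  exact this hs.1

/-- The code of `b` uses `u + t / u` on the whole disc, also where `b` is not glued to `V`. If this
value lies in `D(t)`, both roots are less than `δ - √|t|` in absolute value, so `b` is in the
glueing annulus after all. -/
theorem mk_eq_schiffer (h : Admissible a z δ) (b : base z δ) (v : Σ _ : J, schifferPatch δ)
    (he : pointCode z δ b.1 = .inr (.inl (v.1, v.2.1))) :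
    Total.mk h (.inl b) = Total.mk h (.inr (.inl v)) := by
  by_cases hi : ∃ i, b.1.1 ∈ disc (z i) δ
  · obtain ⟨j | k, hi⟩ := hi
    · rw [pointCode_of_mem h hi] at he
      obtain ⟨j', v⟩ := v
      simp only [centreCode, Sum.inr.injEq, Sum.inl.injEq, Prod.mk.injEq] at he
      obtain ⟨rfl, he⟩ := he
      have h1 := sqrt_lt_coord b j hi
      have hu0 : z (.inl j) b.1.1 ≠ 0 := norm_pos_iff.1 ((Real.sqrt_nonneg _).trans_lt h1)
      refine Quot.sound (.schiffer j b v hi.1 h1 (norm_lt_of_add_div_mem_region hu0 ?_) he.symm)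
      have := v.2.2
      rwa [← he] at this
    · rw [pointCode_of_mem h hi] at he
      rcases k with f | f <;> simp [centreCode] at he
  · push Not at hi
    rw [pointCode_of_notMem hi] at he
    cases he

/-- The code of a patch point is the point itself. Fay discs are absorbed into `S`, so the remaining
comparisons involve points of `𝒳⁰` at a Schiffer centre, where `|z| > √|t|` singles out the larger
root, and points outside all discs. -/
theorem code_injective (h : Admissible a z δ) : Function.Injective (code h) := by
  -- each point lies on a patch or is a point of `𝒳⁰` outside the Fay discs
  have red : ∀ m : Total h, (∃ b : base z δ, (∀ k, b.1.1 ∉ disc (z (.inr k)) δ) ∧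
      m = Total.mk h (.inl b)) ∨ (∃ v, m = Total.mk h (.inr (.inl v))) ∨
      ∃ s, m = Total.mk h (.inr (.inr s)) := by
    intro m
    obtain ⟨y, rfl⟩ := Quot.exists_rep m
    rcases y with b | v | s
    · by_cases hk : ∃ k, b.1.1 ∈ disc (z (.inr k)) δ
      · obtain ⟨k, hk⟩ := hk
        exact .inr (.inr (exists_glue_fay h b k hk))
      · push Not at hk
        exact .inl ⟨b, hk, rfl⟩
    · exact .inr (.inl ⟨v, rfl⟩)
    · exact .inr (.inr ⟨s, rfl⟩)
  have nofay : ∀ b : base z δ, (∀ k, b.1.1 ∉ disc (z (.inr k)) δ) → ∀ s,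
      pointCode z δ b.1 ≠ .inr (.inr s) := by
    intro b hb s he
    by_cases hi : ∃ i, b.1.1 ∈ disc (z i) δ
    · obtain ⟨j | k, hi⟩ := hi
      · rw [pointCode_of_mem h hi] at he
        cases he
      · exact hb k hi
    · push Not at hi
      rw [pointCode_of_notMem hi] at he
      cases he
  intro m m' he
  rcases red m with ⟨b, hb, rfl⟩ | ⟨v, rfl⟩ | ⟨s, rfl⟩ <;>
    rcases red m' with ⟨b', hb', rfl⟩ | ⟨v', rfl⟩ | ⟨s', rfl⟩
  · simp only [code_mk_inl] at he
    by_cases hi : ∃ i, b.1.1 ∈ disc (z i) δ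
    · obtain ⟨j | k, hi⟩ := hi
      · by_cases hi' : ∃ i, b'.1.1 ∈ disc (z i) δ
        · obtain ⟨j' | k, hi'⟩ := hi'
          · rw [pointCode_of_mem h hi, pointCode_of_mem h hi'] at he
            simp only [centreCode, Sum.inr.injEq, Sum.inl.injEq, Prod.mk.injEq] at he
            obtain ⟨rfl, he, ht⟩ := he
            have h1 := sqrt_lt_coord b' j hi'
            rw [← ht] at h1 he
            have := eq_of_add_div_eq (sqrt_lt_coord b j hi) h1 he
            have : b = b' := Subtype.ext (Prod.ext ((z _).injOn hi.1 hi'.1 this) ht)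
            rw [this]
          · exact absurd hi' (hb' k)
        · push Not at hi'
          rw [pointCode_of_mem h hi, pointCode_of_notMem hi'] at he
          cases he
      · exact absurd hi (hb k)
    · push Not at hi
      rw [pointCode_of_notMem hi] at he
      by_cases hi' : ∃ i, b'.1.1 ∈ disc (z i) δ
      · obtain ⟨j' | k, hi'⟩ := hi'
        · rw [pointCode_of_mem h hi'] at he
          cases he
        · exact absurd hi' (hb' k)
      · push Not at hi'
        rw [pointCode_of_notMem hi'] at he
        rw [Subtype.ext (Sum.inl.inj he)]
  · exact mk_eq_schiffer h b v' he
  · exact absurd he (nofay b hb _)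
  · exact (mk_eq_schiffer h b' v he.symm).symm
  · have := Sum.inl.inj (Sum.inr.inj he)
    grind
  · cases he
  · exact absurd he.symm (nofay b' hb' _)
  · cases he
  · have := Sum.inr.inj (Sum.inr.inj he)
    grind

/-- The parameter `t` of a code. -/
def Code.param : Code X J F → ℂ
  | .inl p => p.2
  | .inr (.inl v) => v.2.2
  | .inr (.inr s) => s.2.1 * s.2.2

theorem param_code (h : Admissible a z δ) (m : Total h) : (code h m).param = proj h m := by
  obtain ⟨y, rfl⟩ := Quot.exists_rep m
  rcases y with b | v | s
  · change (pointCode z δ b.1).param = b.1.2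
    by_cases hi : ∃ i, b.1.1 ∈ disc (z i) δ
    · obtain ⟨j | k, hi⟩ := hi
      · rw [pointCode_of_mem h hi]; rfl
      · rw [pointCode_of_mem h hi]
        have := coord_ne_zero h b k hi
        rcases k with f | f
        · exact mul_div_cancel₀ _ this
        · exact div_mul_cancel₀ _ this
    · push Not at hi
      rw [pointCode_of_notMem hi]; rfl
  · rfl
  · rfl

/-- The codes of points of the total space. -/
def Code.IsValid (z : Centre J F → OpenPartialHomeomorph X ℂ) (δ : ℝ) (c : Code X J F) : Prop :=
  ‖c.param‖ < δ ^ 2 / 4 ∧ match c with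
  | .inl p => ∀ i, p.1 ∉ disc (z i) δ
  -- The bound is `δ` and not `δ - √|t|`: these codes also cover the points of the coordinate disc
  -- in `𝒳⁰` that lie beyond `D(t)`.
  | .inr (.inl v) => ∃ x y : ℂ, x + y = v.2.1 ∧ x * y = v.2.2 ∧ ‖x‖ < δ ∧ ‖y‖ < δ
  | .inr (.inr s) => ‖s.2.1‖ < δ ∧ ‖s.2.2‖ < δ

theorem norm_proj_lt (h : Admissible a z δ) (m : Total h) : ‖proj h m‖ < δ ^ 2 / 4 := by
  obtain ⟨y, rfl⟩ := Quot.exists_rep m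
  rcases y with b | v | s
  · exact b.2.1
  · exact v.2.2.1
  · exact s.2.2.2.2

theorem isValid_code (h : Admissible a z δ) (m : Total h) : (code h m).IsValid z δ := by
  refine ⟨by rw [param_code]; exact norm_proj_lt h m, ?_⟩
  obtain ⟨y, rfl⟩ := Quot.exists_rep m
  rcases y with b | v | s
  · by_cases hi : ∃ i, b.1.1 ∈ disc (z i) δ
    · obtain ⟨j | k, hi⟩ := hi
      · change match pointCode z δ b.1 with | .inl p => _ | .inr (.inl v) => _ | .inr (.inr s) => _
        rw [pointCode_of_mem h hi]
        have h1 := sqrt_lt_coord b j hi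
        have hu0 : z (.inl j) b.1.1 ≠ 0 := norm_pos_iff.1 ((Real.sqrt_nonneg _).trans_lt h1)
        refine ⟨_, _, rfl, mul_div_cancel₀ _ hu0, hi.2, (norm_div_le_sqrt h1).trans_lt ?_⟩
        linarith [sqrt_lt h b.2.1, h.pos]
      · obtain ⟨s, hs⟩ := exists_glue_fay h b k hi
        change match code h (Total.mk h (.inl b)) with
          | .inl p => _ | .inr (.inl v) => _ | .inr (.inr s) => _
        rw [hs]
        exact ⟨s.2.2.1, s.2.2.2.1⟩
    · push Not at hi
      change match pointCode z δ b.1 with | .inl p => _ | .inr (.inl v) => _ | .inr (.inr s) => _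
      rw [pointCode_of_notMem hi]
      exact hi
  · obtain ⟨-, x, y, h1, h2, hx, hy⟩ := v.2.2
    have := Real.sqrt_nonneg ‖v.2.1.2‖
    exact ⟨x, y, h1, h2, by linarith, by linarith⟩
  · exact ⟨s.2.2.1, s.2.2.2.1⟩

/-- With `t = x y`, the bound `|t| < δ ^ 2 / 4` gives `√|t| < δ / 2 < δ - √|t|`. So a root too large
for `D(t)` is the coordinate of a point that has not been deleted. -/
theorem sqrt_norm_mul_lt {x y : ℂ} (hxy : ‖x * y‖ < δ ^ 2 / 4)
    (hδ : 0 < δ) (hx : δ - √‖x * y‖ ≤ ‖x‖) : √‖x * y‖ < ‖x‖ := by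
  have : √‖x * y‖ < δ / 2 := by
    rw [Real.sqrt_lt' (by positivity)]; nlinarith
  linarith

theorem mem_disc_symm (h : Admissible a z δ) (i : Centre J F) {u : ℂ} (hu : ‖u‖ < δ) :
    (z i).symm u ∈ disc (z i) δ ∧ z i ((z i).symm u) = u := by
  have htar : u ∈ (z i).target := h.ball_subset i (mem_ball_zero_iff.2 hu)
  have hz : z i ((z i).symm u) = u := (z i).right_inv htar
  exact ⟨⟨(z i).map_target htar, by rwa [hz]⟩, hz⟩

/-- All deleted sets lie in the discs of radius `δ / 2`. Since the discs of radius `δ` are disjoint,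
only the deletion at `j` itself matters. -/
theorem mem_base_of_disc (h : Admissible a z δ) {j : J} {p : X × ℂ} (ht : ‖p.2‖ < δ ^ 2 / 4)
    (hp : p.1 ∈ disc (z (.inl j)) δ) (hlt : √‖p.2‖ < ‖z (.inl j) p.1‖) : p ∈ base z δ := by
  have hδ := h.pos
  have key : ∀ i, p.1 ∈ (z i).source → ‖z i p.1‖ ≤ δ / 2 → i = .inl j := fun i hs hle =>
    eq_of_mem_disc h ⟨hs, by linarith⟩ hp
  refine ⟨ht, ?_, ?_⟩
  · rintro j' ⟨hs, hle⟩
    have := key _ hs (hle.trans (sqrt_lt h ht).le)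
    rw [this] at hle
    exact absurd hlt (not_lt.2 hle)
  · rintro k ⟨hs, hle⟩
    have := key _ hs (hle.trans (div_lt h ht).le)
    cases this

theorem mem_base_of_notMem (h : Admissible a z δ) {p : X × ℂ} (ht : ‖p.2‖ < δ ^ 2 / 4)
    (hp : ∀ i, p.1 ∉ disc (z i) δ) : p ∈ base z δ := by
  have hδ := h.pos
  refine ⟨ht, ?_, ?_⟩
  · rintro j' ⟨hs, hle⟩
    exact hp _ ⟨hs, by linarith [sqrt_lt h ht]⟩
  · rintro k ⟨hs, hle⟩
    exact hp _ ⟨hs, by linarith [div_lt h ht]⟩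

/-- The point of a total space at a Schiffer centre `j` given by a pair `x`, `y` of numbers with
`√|x y| < |x| < δ`. -/
theorem exists_base_of_sqrt_lt (h : Admissible a z δ) (j : J) {x y : ℂ} (hxy : ‖x * y‖ < δ ^ 2 / 4)
    (hx : ‖x‖ < δ) (hlt : √‖x * y‖ < ‖x‖) :
    ∃ hb : ((z (.inl j)).symm x, x * y) ∈ base z δ,
      code h (Total.mk h (.inl ⟨_, hb⟩)) = .inr (.inl (j, (x + y, x * y))) := by
  have hx0 : x ≠ 0 := norm_pos_iff.1 ((Real.sqrt_nonneg _).trans_lt hlt)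
  obtain ⟨hd, hz⟩ := mem_disc_symm h (.inl j) hx
  refine ⟨mem_base_of_disc h hxy hd (by rwa [hz]), ?_⟩
  rw [code_mk_inl, pointCode_of_mem h hd]
  simp only [centreCode, hz, mul_div_cancel_left₀ _ hx0]

/-- For a code at a Schiffer centre, either both roots are less than `δ - √|t|` in absolute value
and the point lies in `V`, or one root is larger and serves as the coordinate of a point of `𝒳⁰`. -/
theorem exists_code_eq (h : Admissible a z δ) {c : Code X J F} (hc : c.IsValid z δ) :
    ∃ m, code h m = c := by
  obtain ⟨ht, hc⟩ := hc
  rcases c with p | ⟨j, w, t⟩ | s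
  · exact ⟨Total.mk h (.inl ⟨p, mem_base_of_notMem h ht hc⟩), pointCode_of_notMem hc⟩
  · obtain ⟨x, y, h1, h2, hx, hy⟩ := hc
    simp only at h1 h2
    subst h1 h2
    change ‖x * y‖ < δ ^ 2 / 4 at ht
    by_cases hx' : ‖x‖ < δ - √‖x * y‖
    · by_cases hy' : ‖y‖ < δ - √‖x * y‖
      · exact ⟨Total.mk h (.inr (.inl ⟨j, ⟨(_, _), ht, x, y, rfl, rfl, hx', hy'⟩⟩)), rfl⟩
      · rw [mul_comm] at ht hy'
        obtain ⟨hb, e⟩ := exists_base_of_sqrt_lt h j ht hy (sqrt_norm_mul_lt ht h.pos (not_lt.1 hy'))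
        exact ⟨_, e.trans (by rw [add_comm, mul_comm])⟩
    · obtain ⟨hb, e⟩ := exists_base_of_sqrt_lt h j ht hx (sqrt_norm_mul_lt ht h.pos (not_lt.1 hx'))
      exact ⟨_, e⟩
  · exact ⟨Total.mk h (.inr (.inr ⟨s.1, ⟨s.2, hc.1, hc.2, ht⟩⟩)), rfl⟩

theorem code_centralMap (h : Admissible a z δ) (x : X) :
    code h (centralMap h x) = pointCode z δ (x, 0) := by
  by_cases hx : ∃ i, x = a i
  · obtain ⟨i, rfl⟩ := hx
    rw [centralMap_centre, pointCode_of_mem h (centre_mem_disc h i)]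
    -- At a centre with `t = 0` the convention `0 / 0 = 0` makes `pointCode` return `(0, 0)`, the
    -- code of the origin of the patch.
    rcases i with j | f | f <;> simp [origin, centreCode, h.map_centre]
  · push Not at hx
    rw [centralMap_of_ne h hx, code_mk_inl]

end Code

/-! ### Holomorphy checked in the parametrizations. -/

section Smooth

variable {X : Type*} [TopologicalSpace X] [T2Space X] [ChartedSpace ℂ X] [IsManifold 𝓘(ℂ, ℂ) ω X]
  {J F : Type*} [Finite J] [Finite F]
  {a : Centre J F → X} {z : Centre J F → OpenPartialHomeomorph X ℂ} {δ : ℝ}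
  {X' : Type*} [TopologicalSpace X'] [T2Space X'] [ChartedSpace ℂ X'] [IsManifold 𝓘(ℂ, ℂ) ω X']
  {J' F' : Type*} [Finite J'] [Finite F']
  {a' : Centre J' F' → X'} {z' : Centre J' F' → OpenPartialHomeomorph X' ℂ} {δ' : ℝ}

/-- A map of total spaces that is holomorphic in some parametrizations is holomorphic. -/
theorem contMDiffAt_of_rep {h : Admissible a z δ} {h' : Admissible a' z' δ'}
    {H : Total h → Total h'} {α : X ⊕ (J ⊕ F)} {β : X' ⊕ (J' ⊕ F')} {p : ℂ × ℂ} {y : Pieces z δ}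
    {y' : Pieces z' δ'} {φ : ℂ × ℂ → ℂ × ℂ} (hy : Rep z δ α p y) (hφ : ContDiffAt ℂ ω φ p)
    (hy' : Rep z' δ' β (φ p) y')
    (hev : ∀ᶠ q in 𝓝 p, ∀ w w', Rep z δ α q w → Rep z' δ' β (φ q) w' →
      H (Total.mk h w) = Total.mk h' w') :
    ContMDiffAt 𝓘(ℂ, ℂ × ℂ) 𝓘(ℂ, ℂ × ℂ) ω H (Total.mk h y) := by
  set m := Total.mk h y with hm
  have hHm : H m = Total.mk h' y' := hev.self_of_nhds y y' hy hy'
  have hcm := mem_chart_source (ℂ × ℂ) m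
  have hcm' := mem_chart_source (ℂ × ℂ) (H m)
  obtain ⟨α₀, hα₀⟩ : IsChart h (chartAt (ℂ × ℂ) m) := chart_mem_atlas (ℂ × ℂ) m
  obtain ⟨β₀, hβ₀⟩ : IsChart h' (chartAt (ℂ × ℂ) (H m)) := chart_mem_atlas (ℂ × ℂ) (H m)
  have hcA : chartAt (ℂ × ℂ) m ∈ IsManifold.maximalAtlas 𝓘(ℂ, ℂ × ℂ) ω (Total h) :=
    IsManifold.chart_mem_maximalAtlas m
  have hcA' : chartAt (ℂ × ℂ) (H m) ∈ IsManifold.maximalAtlas 𝓘(ℂ, ℂ × ℂ) ω (Total h') :=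
    IsManifold.chart_mem_maximalAtlas (H m)
  generalize chartAt (ℂ × ℂ) m = c at hcm hα₀ hcA
  generalize chartAt (ℂ × ℂ) (H m) = c' at hcm' hβ₀ hcA'
  obtain ⟨y₀, hy₀, e₀⟩ := hα₀ (c m) (c.map_source hcm)
  obtain ⟨y₁, hy₁, e₁⟩ := hβ₀ (c' (H m)) (c'.map_source hcm')
  rw [c.left_inv hcm] at e₀
  rw [c'.left_inv hcm'] at e₁
  -- The preferred charts `c`, `c'` may invert other parametrizations than `α`, `β`. The coordinate
  -- changes `ψ` and `χ` pass from that of `c` to `α` and from `β` to that of `c'`.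
  obtain ⟨ψ, hψ, hψm, hψe⟩ := trans_of_eq h e₀ hy₀ hy
  obtain ⟨χ, hχ, hχm, hχe⟩ := trans_of_eq h' (hHm.symm.trans e₁.symm) hy' hy₁
  have hφ' : ContDiffAt ℂ ω φ (ψ (c m)) := by rwa [hψm]
  have hχ' : ContDiffAt ℂ ω χ (φ (ψ (c m))) := by rwa [hψm]
  have hg : ContDiffAt ℂ ω (fun q => χ (φ (ψ q))) (c m) :=
    hχ'.comp (c m) (hφ'.comp (c m) hψ)
  have hgm : χ (φ (ψ (c m))) = c' (H m) := by rw [hψm, hχm]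
  have hsm : ContMDiffAt 𝓘(ℂ, ℂ × ℂ) 𝓘(ℂ, ℂ × ℂ) ω
      (fun m' => c'.symm (χ (φ (ψ (c m'))))) m := by
    have h1 := contMDiffAt_of_mem_maximalAtlas hcA hcm
    have h2 : ContMDiffAt 𝓘(ℂ, ℂ × ℂ) 𝓘(ℂ, ℂ × ℂ) ω c'.symm (χ (φ (ψ (c m)))) := by
      rw [hgm]
      exact contMDiffAt_symm_of_mem_maximalAtlas hcA' (c'.map_source hcm')
    exact h2.comp m (hg.contMDiffAt.comp m h1)
  -- It remains to see that `H` agrees near `m` with the holomorphic composite `c'.symm ∘ χ ∘ φ ∘ ψ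
  -- ∘ c`.
  refine hsm.congr_of_eventuallyEq ?_
  have hc : ContinuousAt c m := c.continuousAt hcm
  have hψc : Tendsto (fun m' => ψ (c m')) (𝓝 m) (𝓝 p) := by
    rw [← hψm]; exact hψ.continuousAt.tendsto.comp hc
  have hφc : Tendsto (fun m' => φ (ψ (c m'))) (𝓝 m) (𝓝 (φ p)) :=
    hφ.continuousAt.tendsto.comp hψc
  have hχc : Tendsto (fun m' => χ (φ (ψ (c m')))) (𝓝 m) (𝓝 (c' (H m))) := by
    rw [← hχm]; exact hχ.continuousAt.tendsto.comp hφc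
  filter_upwards [c.open_source.mem_nhds hcm, hc.eventually hψe, hψc.eventually hev,
    hφc.eventually hχe, hχc.eventually (c'.open_target.mem_nhds (c'.map_source hcm'))]
    with m' h0 ⟨w₀, w, hw₀, hw, ew⟩ h2 ⟨w', w₁, hw', hw₁, ew'⟩ h4
  obtain ⟨v₀, hv₀, ev₀⟩ := hα₀ (c m') (c.map_source h0)
  obtain ⟨v₁, hv₁, ev₁⟩ := hβ₀ _ h4
  rw [c.left_inv h0] at ev₀
  have hH : H m' = Total.mk h' w₁ := by
    rw [← ev₀, hv₀.unique hw₀, ew, h2 w w' hw hw', ew']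
  rw [hH, ← ev₁, hv₁.unique hw₁]

end Smooth

/-! ### Admissibility of small radii. -/

section Small

variable {X : Type*} [TopologicalSpace X] [T2Space X] [ChartedSpace ℂ X]

/-- Local coordinates at finitely many distinct points are admissible for every sufficiently
small radius. -/
theorem exists_admissible {ι : Type*} [Finite ι] {a : ι → X}
    (ha : Function.Injective a) {z : ι → OpenPartialHomeomorph X ℂ}
    (hz : ∀ i, z i ∈ IsManifold.maximalAtlas 𝓘(ℂ, ℂ) ω X) (has : ∀ i, a i ∈ (z i).source)
    (ha0 : ∀ i, z i (a i) = 0) :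
    ∃ δ₀ > 0, ∀ δ, 0 < δ → δ < δ₀ → Admissible a z δ := by
  obtain ⟨U, hU, hUd⟩ := (Set.toFinite (range a)).t2_separation
  have key : ∀ i, ∃ ε > 0, Metric.ball 0 ε ⊆ (z i).target ∩ (z i).symm ⁻¹' U (a i) := by
    intro i
    have h0 : (0 : ℂ) ∈ (z i).target := ha0 i ▸ (z i).map_source (has i)
    have hs : (z i).symm 0 = a i := by rw [← ha0 i, (z i).left_inv (has i)]
    refine Metric.mem_nhds_iff.1 (inter_mem ((z i).open_target.mem_nhds h0) ?_)
    exact (z i).continuousAt_symm h0 (by rw [hs]; exact (hU _).2.mem_nhds (hU _).1)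
  choose ε hε hsub using key
  obtain ⟨δ₀, hδ₀, hle⟩ : ∃ δ₀ > 0, ∀ i, δ₀ ≤ ε i := by
    rcases isEmpty_or_nonempty ι with _ | _
    · exact ⟨1, one_pos, fun i => isEmptyElim i⟩
    · obtain ⟨i, hi⟩ := Finite.exists_min ε
      exact ⟨ε i, hε i, hi⟩
  refine ⟨δ₀, hδ₀, fun δ h1 h2 => ⟨h1, hz, has, ha0, fun i => ?_, fun i i' hne => ?_⟩⟩
  · exact (Metric.ball_subset_ball (h2.le.trans (hle i))).trans
      ((hsub i).trans inter_subset_left)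
  · have hd : ∀ i, disc (z i) δ ⊆ U (a i) := by
      rintro i x ⟨hx, hlt⟩
      have := (hsub i (mem_ball_zero_iff.2 (hlt.trans (h2.trans_le (hle i))))).2
      rwa [mem_preimage, (z i).left_inv hx] at this
    exact (hUd (mem_range_self i) (mem_range_self i') (ha.ne hne)).mono (hd i) (hd i')

end Small

/-! ### The preimage of the coordinate disc at `e`. -/

section Cover

set_option linter.unusedSectionVars false

variable {C : Type*} [TopologicalSpace C] [ChartedSpace ℂ C]
  {B : Type*} [TopologicalSpace B] [ChartedSpace ℂ B] {J F : Type*}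
  {a : Centre J F → C} {z : Centre J F → OpenPartialHomeomorph C ℂ} {δ : ℝ}
  {e : B} {ze : OpenPartialHomeomorph B ℂ}

/-- Near the centres, the map `h` is the identity in the coordinates `z i` and `ze`, and the
coordinate discs of radius `δ` at the centres are the preimage of the one at `e`. -/
structure IsAdapted (h : C → B) (z : Centre J F → OpenPartialHomeomorph C ℂ)
    (ze : OpenPartialHomeomorph B ℂ) (δ : ℝ) : Prop where
  mapsTo : ∀ i, MapsTo h (z i).source ze.source
  eqOn : ∀ i, EqOn (z i) (ze ∘ h) (z i).source
  exists_mem_disc : ∀ x, h x ∈ disc ze δ → ∃ i, x ∈ disc (z i) δ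

theorem mem_disc_map {h : C → B} (hzm : ∀ i, MapsTo h (z i).source ze.source)
    (hzh : ∀ i, EqOn (z i) (ze ∘ h) (z i).source) {i : Centre J F} {x : C}
    (hx : x ∈ disc (z i) δ) : h x ∈ disc ze δ ∧ ze (h x) = z i x := by
  have he : ze (h x) = z i x := (hzh i hx.1).symm
  exact ⟨⟨hzm i hx.1, he ▸ hx.2⟩, he⟩

theorem infinite_of_mem_nhds_complex [T2Space C] {x : C} {s : Set C} (hs : s ∈ 𝓝 x) :
    s.Infinite := by
  intro hfin
  have h1 : chartAt ℂ x '' s ∈ 𝓝 (chartAt ℂ x x) := by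
    have := (chartAt ℂ x).map_nhds_eq (mem_chart_source ℂ x)
    rw [← this]
    exact image_mem_map hs
  exact infinite_of_mem_nhds _ h1 (hfin.image _)

/-- If all but finitely many fibres of `h` have as many points as there are centres, then the
preimage of the coordinate disc at `e` is the union of the discs at the centres. -/
theorem isAdapted [T2Space C] [Finite J] [Finite F] {h : C → B} (hh : Continuous h)
    (hdeg : HasDegree h (Nat.card (Centre J F))) (hA : Admissible a z δ)
    (hzm : ∀ i, MapsTo h (z i).source ze.source)
    (hzh : ∀ i, EqOn (z i) (ze ∘ h) (z i).source) : IsAdapted h z ze δ := by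
  refine ⟨hzm, hzh, fun x hx => ?_⟩
  by_contra! hno
  -- the local sections of `h` over the disc
  set s : Centre J F → B → C := fun i y => (z i).symm (ze y) with hs
  have hsd : ∀ i, ∀ y ∈ disc ze δ, s i y ∈ disc (z i) δ ∧ h (s i y) = y := by
    intro i y hy
    obtain ⟨h1, h2⟩ := mem_disc_symm hA i hy.2
    obtain ⟨h3, h4⟩ := mem_disc_map hzm hzh h1
    exact ⟨h1, ze.injOn h3.1 hy.1 (h4.trans h2)⟩
  have hev : ∀ᶠ x' in 𝓝 x, h x' ∈ disc ze δ :=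
    hh.continuousAt.eventually
      ((ze.continuousOn.norm.isOpen_inter_preimage ze.open_source
        (isOpen_Iio (a := δ))).mem_nhds hx)
  have hev' : ∀ i, ∀ᶠ x' in 𝓝 x, s i (h x') ≠ x' := by
    intro i
    have hc : ContinuousAt (fun x' => s i (h x')) x := by
      have h1 : ContinuousAt (fun x' => ze (h x')) x :=
        ContinuousAt.comp (g := ze) (ze.continuousAt hx.1) hh.continuousAt
      refine ContinuousAt.comp (g := (z i).symm) ((z i).continuousAt_symm ?_) h1
      exact hA.ball_subset i (mem_ball_zero_iff.2 hx.2)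
    have hne : (s i (h x), x) ∈ (diagonal C)ᶜ :=
      fun (he : s i (h x) = x) => hno i (he ▸ (hsd i _ hx).1)
    exact (hc.prodMk continuousAt_id).eventually (isClosed_diagonal.isOpen_compl.mem_nhds hne)
  -- If `x` over the disc lay in none of the discs `disc (z i) δ`, it would avoid all the sections,
  -- and by the Hausdorff property so would all points near `x`.
  have hN := hev.and (eventually_all.2 hev')
  have hsub : {x' | h x' ∈ disc ze δ ∧ ∀ i, s i (h x') ≠ x'} ⊆
      ⋃ y ∈ {y | (h ⁻¹' {y}).ncard ≠ Nat.card (Centre J F)}, h ⁻¹' {y} := by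
    rintro x' ⟨h1, h2⟩
    refine mem_iUnion₂.2 ⟨h x', ?_, rfl⟩
    have := Fintype.ofFinite (Centre J F)
    -- The values of the sections lie in disjoint discs, so together with `x'` they give one more
    -- point in the fibre than there are centres. Thus a whole neighbourhood of `x` lies in finitely
    -- many finite exceptional fibres, although it is infinite.
    let g : Option (Centre J F) → h ⁻¹' {h x'} := fun o =>
      o.elim ⟨x', rfl⟩ fun i => ⟨s i (h x'), (hsd i _ h1).2⟩
    have hg : Function.Injective g := by
      rintro (_ | i) (_ | i') hii
      · rfl
      · exact absurd (congrArg Subtype.val hii).symm (h2 i')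
      · exact absurd (congrArg Subtype.val hii) (h2 i)
      · have e1 : s i (h x') = s i' (h x') := congrArg Subtype.val hii
        rw [eq_of_mem_disc hA (hsd i _ h1).1 (e1 ▸ (hsd i' _ h1).1)]
    have hfin : Finite (h ⁻¹' {h x'}) := hdeg.1 (h x')
    have hle := Nat.card_le_card_of_injective g hg
    rw [Finite.card_option, Nat.card_coe_set_eq] at hle
    intro heq
    omega
  exact infinite_of_mem_nhds_complex hN ((hdeg.2.biUnion fun y _ => hdeg.1 y).subset hsub)

/-! ### The map of total spaces and its holomorphy. -/

/-- The map of total spaces, on the level of codes: `h` outside the discs, the identity at the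
Schiffer centres and `w = X + Y`, `t = X Y` at the Fay pairs. -/
def coverCode (h : C → B) : Code C J F → Code B Unit Empty
  | .inl p => .inl (h p.1, p.2)
  | .inr (.inl v) => .inr (.inl ((), v.2))
  | .inr (.inr s) => .inr (.inl ((), (s.2.1 + s.2.2, s.2.1 * s.2.2)))

theorem param_coverCode (h : C → B) (c : Code C J F) : (coverCode h c).param = c.param := by
  rcases c with p | v | s <;> rfl

/-- This makes the map well defined. At a Fay pair `X`, `Y` themselves are the two roots required;
outside the discs of `C`, the preimage property in `IsAdapted` keeps the image out of the disc at
`e`. -/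
theorem isValid_coverCode {h : C → B} (ha : IsAdapted h z ze δ) {c : Code C J F}
    (hc : c.IsValid z δ) :
    (coverCode h c).IsValid (fun _ : Centre Unit Empty => ze) δ := by
  refine ⟨by rw [param_coverCode]; exact hc.1, ?_⟩
  rcases c with p | v | s
  · intro _ hp
    obtain ⟨i, hi⟩ := ha.exists_mem_disc _ hp
    exact hc.2 i hi
  · exact hc.2
  · exact ⟨_, _, rfl, rfl, hc.2⟩

/-- On points of `C × ℂ` the map is `h × id`, because `z i` and `ze ∘ h` agree. The condition at Fay
centres is what `u * (t / u) = t` needs when `u = 0`; it holds both on `𝒞⁰`, where `u ≠ 0`, and for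
`t = 0`. -/
theorem coverCode_pointCode {h : C → B} (ha : IsAdapted h z ze δ) (hC : Admissible a z δ)
    (hB : Admissible (ι := Centre Unit Empty) (fun _ => e) (fun _ => ze) δ) {p : C × ℂ}
    (hne : ∀ k, p.1 ∈ disc (z (.inr k)) δ → z (.inr k) p.1 = 0 → p.2 = 0) :
    coverCode h (pointCode z δ p) =
      pointCode (fun _ : Centre Unit Empty => ze) δ (h p.1, p.2) := by
  by_cases hi : ∃ i, p.1 ∈ disc (z i) δ
  · obtain ⟨i, hi⟩ := hi
    obtain ⟨h1, h2⟩ := mem_disc_map ha.mapsTo ha.eqOn hi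
    rw [pointCode_of_mem hC hi, pointCode_of_mem hB (i := .inl ()) h1]
    simp only [h2]
    rcases i with j | k
    · rfl
    · have h3 : z (.inr k) p.1 * (p.2 / z (.inr k) p.1) = p.2 :=
        mul_div_cancel_of_imp' (hne k hi)
      rcases k with f | f
      · simp only [centreCode, coverCode, h3]
      · simp only [centreCode, coverCode]
        rw [add_comm, mul_comm, h3]
  · push Not at hi
    rw [pointCode_of_notMem hi, pointCode_of_notMem]
    · rfl
    · intro _ hp
      obtain ⟨i, hi'⟩ := ha.exists_mem_disc _ hp
      exact hi i hi'

/-- The map of total spaces induced by `h`. -/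
noncomputable def coverMap {h : C → B} (ha : IsAdapted h z ze δ) (hC : Admissible a z δ)
    (hB : Admissible (ι := Centre Unit Empty) (fun _ => e) (fun _ => ze) δ) (m : Total hC) :
    Total hB :=
  (exists_code_eq hB (isValid_coverCode ha (isValid_code hC m))).choose

variable {h : C → B} (ha : IsAdapted h z ze δ) (hC : Admissible a z δ)
  (hB : Admissible (ι := Centre Unit Empty) (fun _ => e) (fun _ => ze) δ)

theorem code_coverMap (m : Total hC) : code hB (coverMap ha hC hB m) = coverCode h (code hC m) :=
  (exists_code_eq hB (isValid_coverCode ha (isValid_code hC m))).choose_spec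

theorem proj_coverMap (m : Total hC) : proj hB (coverMap ha hC hB m) = proj hC m := by
  rw [← param_code, code_coverMap, param_coverCode, param_code]

/-- This reduces every identity about the map to a computation with codes; it serves for holomorphy,
the central fibre and the degree. -/
theorem coverMap_eq_iff {m : Total hC} {m' : Total hB} :
    coverMap ha hC hB m = m' ↔ coverCode h (code hC m) = code hB m' := by
  rw [← code_coverMap ha hC hB, (code_injective hB).eq_iff]

theorem coverMap_centralMap (x : C) :
    coverMap ha hC hB (centralMap hC x) = centralMap hB (h x) := by
  rw [coverMap_eq_iff, code_centralMap, code_centralMap, coverCode_pointCode ha hC hB]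
  exact fun _ _ _ => rfl

/-- In suitable parametrizations the map is `h × id`, the identity, `(X, Y) ↦ (X + Y, X Y)`, or,
where `X + Y` is outside `D(t)`, the point of `ℬ⁰` whose coordinate is the larger of `X`, `Y`. -/
theorem contMDiff_coverMap [T2Space C] [IsManifold 𝓘(ℂ, ℂ) ω C] [T2Space B]
    [IsManifold 𝓘(ℂ, ℂ) ω B] [Finite J] [Finite F]
    (hh : ContMDiff 𝓘(ℂ, ℂ) 𝓘(ℂ, ℂ) ω h) :
    ContMDiff 𝓘(ℂ, ℂ × ℂ) 𝓘(ℂ, ℂ × ℂ) ω (coverMap ha hC hB) := by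
  have hδ := hC.pos
  -- at a point of a patch with a coordinate of absolute value at least `δ - √|t|`
  have fay : ∀ (f : F) (s : fayPatch δ) (ξ η : ℂ × ℂ → ℂ), ContDiff ℂ ω ξ →
      (∀ q, ξ q * η q = q.1 * q.2) → (∀ q, ξ q + η q = q.1 + q.2) → ‖ξ s.1‖ < δ →
      δ - √‖s.1.1 * s.1.2‖ ≤ ‖ξ s.1‖ → ContMDiffAt 𝓘(ℂ, ℂ × ℂ) 𝓘(ℂ, ℂ × ℂ) ω
        (coverMap ha hC hB) (Total.mk hC (.inr (.inr ⟨f, s⟩))) := by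
    intro f s ξ η hξ hmul hadd hlt hle
    have ht := s.2.2.2
    rw [← hmul] at ht hle
    -- Here `ξ` is the large one of the coordinates `X`, `Y` and `η` the other. The bound just
    -- obtained places the image at the point of `ℬ⁰` with `z_e = ξ`, so no square root is needed to
    -- write the map.
    have hlt' := sqrt_norm_mul_lt ht hδ hle
    obtain ⟨hb, -⟩ := exists_base_of_sqrt_lt hB () ht hlt hlt'
    have htar : ξ s.1 ∈ ze.target := hB.ball_subset (.inl ()) (mem_ball_zero_iff.2 hlt)
    have hsrc : ze.symm (ξ s.1) ∈ (chartAt ℂ (ze.symm (ξ s.1))).source := mem_chart_source _ _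
    refine contMDiffAt_of_rep (.fay f s.1 s rfl) (y' := .inl ⟨_, hb⟩)
      (β := .inl (ze.symm (ξ s.1)))
      (φ := fun q => (chartAt ℂ (ze.symm (ξ s.1)) (ze.symm (ξ q)), q.1 * q.2)) ?_ ?_ ?_
    · refine ContDiffAt.prodMk ?_ (contDiffAt_fst.mul contDiffAt_snd)
      exact (contDiffAt_right hB _ (.inl ()) htar hsrc).comp s.1 hξ.contDiffAt
    · refine .base _ _ _ ((chartAt ℂ _).map_source hsrc) ?_
      ext
      · exact ((chartAt ℂ _).left_inv hsrc).symm
      · exact hmul _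
    · have hξc := hξ.continuous
      have e₁ : ∀ᶠ q : ℂ × ℂ in 𝓝 s.1, ‖ξ q‖ < δ :=
        ContinuousAt.eventually_lt (by fun_prop) (by fun_prop) hlt
      have e₂ : ∀ᶠ q : ℂ × ℂ in 𝓝 s.1, √‖q.1 * q.2‖ < ‖ξ q‖ :=
        ContinuousAt.eventually_lt (by fun_prop) (by fun_prop) (by rwa [hmul] at hlt')
      have hc : ContinuousAt (fun q => ze.symm (ξ q)) s.1 :=
        ContinuousAt.comp (g := ze.symm) (ze.continuousAt_symm htar) hξc.continuousAt
      have e₃ := hc.eventually ((chartAt ℂ _).open_source.mem_nhds hsrc)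
      filter_upwards [e₁, e₂, e₃] with q h1 h2 h3 w w' hw hw'
      cases hw with
      | fay _ _ s' hs' =>
      cases hw' with
      | base _ _ b hp hb' =>
      rw [(chartAt ℂ _).left_inv h3] at hb'
      rw [← hmul] at h2 hb'
      have ht' := s'.2.2.2
      rw [hs', ← hmul] at ht'
      obtain ⟨hb₁, hcode⟩ := exists_base_of_sqrt_lt hB () ht' h1 h2
      have : b = ⟨_, hb₁⟩ := Subtype.ext hb'
      rw [coverMap_eq_iff, this, hcode, code_mk_fay, hs', hmul, hadd]
      rfl
  have fay' : ∀ s : Σ _ : F, fayPatch δ, ContMDiffAt 𝓘(ℂ, ℂ × ℂ) 𝓘(ℂ, ℂ × ℂ) ω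
      (coverMap ha hC hB) (Total.mk hC (.inr (.inr s))) := by
    rintro ⟨f, s⟩
    by_cases hx : ‖s.1.1‖ < δ - √‖s.1.1 * s.1.2‖
    · by_cases hy : ‖s.1.2‖ < δ - √‖s.1.1 * s.1.2‖
      · refine contMDiffAt_of_rep (.fay f s.1 s rfl) (β := .inr (.inl ()))
          (φ := fun q => (q.1 + q.2, q.1 * q.2))
          ((contDiffAt_fst.add contDiffAt_snd).prodMk (contDiffAt_fst.mul contDiffAt_snd))
          (.schiffer () _ ⟨_, s.2.2.2, _, _, rfl, rfl, hx, hy⟩ rfl) (Eventually.of_forall ?_)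
        intro q w w' hw hw'
        cases hw with
        | fay _ _ s' hs' =>
        cases hw' with
        | schiffer _ _ v hv =>
        rw [coverMap_eq_iff, code_mk_fay, code_mk_schiffer, hs', hv]
        rfl
      · exact fay f s Prod.snd Prod.fst contDiff_snd (fun q => mul_comm _ _)
          (fun q => add_comm _ _) s.2.2.1 (not_lt.1 hy)
    · exact fay f s Prod.fst Prod.snd contDiff_fst (fun q => rfl) (fun q => rfl) s.2.1
        (not_lt.1 hx)
  intro m
  obtain ⟨y, rfl⟩ := Quot.exists_rep m
  change ContMDiffAt 𝓘(ℂ, ℂ × ℂ) 𝓘(ℂ, ℂ × ℂ) ω _ (Total.mk hC y)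
  rcases y with b | ⟨j, v⟩ | s
  -- In a Fay disc `h × id` need not map into `ℬ⁰`: only `|z| ≤ |t| / δ` is deleted in `𝒞`, but
  -- `|z_e| ≤ √|t|` in `ℬ`. Such a point is treated as a point of `S`.
  · by_cases hk : ∃ k, b.1.1 ∈ disc (z (.inr k)) δ
    · obtain ⟨k, hk⟩ := hk
      obtain ⟨s, hs⟩ := exists_glue_fay hC b k hk
      rw [hs]
      exact fay' s
    · have hb : (h b.1.1, b.1.2) ∈ base (fun _ : Centre Unit Empty => ze) δ := by
        by_cases hi : ∃ i, b.1.1 ∈ disc (z i) δ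
        · obtain ⟨j | k, hi⟩ := hi
          · obtain ⟨h1, h2⟩ := mem_disc_map ha.mapsTo ha.eqOn hi
            refine mem_base_of_disc hB (j := ()) b.2.1 h1 ?_
            simp only [h2]
            exact sqrt_lt_coord b j hi
          · exact absurd ⟨k, hi⟩ hk
        · refine mem_base_of_notMem hB b.2.1 fun _ hp => hi (ha.exists_mem_disc _ hp)
      have hx := mem_chart_source ℂ b.1.1
      have hy := mem_chart_source ℂ (h b.1.1)
      have hc : ContinuousAt (fun q : ℂ × ℂ => h ((chartAt ℂ b.1.1).symm q.1))
          (chartAt ℂ b.1.1 b.1.1, b.1.2) :=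
        hh.continuous.continuousAt.comp
          (ContinuousAt.comp (g := (chartAt ℂ b.1.1).symm)
            ((chartAt ℂ b.1.1).continuousAt_symm ((chartAt ℂ b.1.1).map_source hx))
            continuousAt_fst)
      have hval : h ((chartAt ℂ b.1.1).symm (chartAt ℂ b.1.1 b.1.1)) = h b.1.1 := by
        rw [(chartAt ℂ b.1.1).left_inv hx]
      have hy' : h ((chartAt ℂ b.1.1).symm (chartAt ℂ b.1.1 b.1.1)) ∈
          (chartAt ℂ (h b.1.1)).source := by rwa [hval]
      refine contMDiffAt_of_rep (p := (chartAt ℂ b.1.1 b.1.1, b.1.2))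
        (.base b.1.1 _ b ((chartAt ℂ b.1.1).map_source hx)
          (Prod.ext ((chartAt ℂ b.1.1).left_inv hx).symm rfl))
        (β := .inl (h b.1.1)) (y' := .inl ⟨_, hb⟩)
        (φ := fun q => (chartAt ℂ (h b.1.1) (h ((chartAt ℂ b.1.1).symm q.1)), q.2)) ?_ ?_ ?_
      · refine ContDiffAt.prodMk ?_ contDiffAt_snd
        have h1 : ContMDiffAt 𝓘(ℂ, ℂ) 𝓘(ℂ, ℂ) ω
            (fun u => chartAt ℂ (h b.1.1) (h ((chartAt ℂ b.1.1).symm u)))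
            (chartAt ℂ b.1.1 b.1.1) := by
          have h2 := contMDiffAt_of_mem_maximalAtlas (I := 𝓘(ℂ, ℂ)) (n := ω)
            (IsManifold.chart_mem_maximalAtlas (h b.1.1)) hy'
          have h3 := contMDiffAt_symm_of_mem_maximalAtlas (I := 𝓘(ℂ, ℂ)) (n := ω)
            (IsManifold.chart_mem_maximalAtlas b.1.1) ((chartAt ℂ b.1.1).map_source hx)
          exact ContMDiffAt.comp (g := chartAt ℂ (h b.1.1)) _ h2
            (ContMDiffAt.comp (g := h) _ (hh _) h3)
        exact (contMDiffAt_iff_contDiffAt.1 h1).comp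
          (f := Prod.fst) ((chartAt ℂ b.1.1 b.1.1, b.1.2) : ℂ × ℂ) contDiffAt_fst
      · simp only [hval]
        exact .base _ _ _ ((chartAt ℂ _).map_source hy)
          (Prod.ext ((chartAt ℂ _).left_inv hy).symm rfl)
      · have e₁ := hc.eventually ((chartAt ℂ (h b.1.1)).open_source.mem_nhds hy')
        filter_upwards [e₁] with q hq w w' hw hw'
        cases hw with
        | base _ _ b₁ _ hb₁ =>
        cases hw' with
        | base _ _ b₂ _ hb₂ =>
        rw [(chartAt ℂ (h b.1.1)).left_inv hq] at hb₂
        rw [coverMap_eq_iff, code_mk_inl, code_mk_inl, coverCode_pointCode ha hC hB, hb₁, hb₂]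
        exact fun k hk h0 => absurd h0 (coord_ne_zero hC b₁ k hk)
  · refine contMDiffAt_of_rep (.schiffer j v.1 v rfl) (β := .inr (.inl ())) (φ := id)
      contDiffAt_id (.schiffer () _ v rfl) (Eventually.of_forall ?_)
    intro q w w' hw hw'
    cases hw with
    | schiffer _ _ v₁ hv₁ =>
    cases hw' with
    | schiffer _ _ v₂ hv₂ =>
    rw [coverMap_eq_iff, code_mk_schiffer, code_mk_schiffer, hv₁, hv₂]
    rfl
  · exact fay' s

end Cover

/-! ### Counting the points of the fibres. -/

section Degree

set_option linter.unusedSectionVars false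

variable {C : Type*} [TopologicalSpace C] [ChartedSpace ℂ C]
  {B : Type*} [TopologicalSpace B] [ChartedSpace ℂ B] {J : Type*}
  {a : Centre J Unit → C} {z : Centre J Unit → OpenPartialHomeomorph C ℂ} {δ : ℝ}
  {e : B} {ze : OpenPartialHomeomorph B ℂ} {h : C → B}

/-- The codes over the point of `B × ℂ` with code `(y, t)`. -/
theorem setOf_coverCode_eq_inl (ha : IsAdapted h z ze δ) {y : B} {t : ℂ}
    (hy : Code.IsValid (fun _ : Centre Unit Empty => ze) δ (.inl (y, t))) :
    {c : Code C J Unit | c.IsValid z δ ∧ coverCode h c = .inl (y, t)} =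
      (fun x => .inl (x, t)) '' (h ⁻¹' {y}) := by
  ext c
  constructor
  · rintro ⟨-, hc⟩
    rcases c with ⟨x, t'⟩ | v | s
    · obtain ⟨rfl, rfl⟩ := Prod.mk.inj (Sum.inl.inj hc)
      exact ⟨x, rfl, rfl⟩
    · cases hc
    · cases hc
  · rintro ⟨x, rfl, rfl⟩
    exact ⟨⟨hy.1, fun i hi => hy.2 (.inl ()) (mem_disc_map ha.mapsTo ha.eqOn hi).1⟩, rfl⟩

/-- The codes of the points over the point with coordinates `(x + y, x y)` of the patch `V`. -/
def patchCode (C : Type*) {J : Type*} (x y : ℂ) : Centre J Unit → Code C J Unit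
  | .inl j => .inr (.inl (j, (x + y, x * y)))
  | .inr (.inl _) => .inr (.inr ((), (x, y)))
  | .inr (.inr _) => .inr (.inr ((), (y, x)))

theorem patchCode_injective {x y : ℂ} (hxy : x ≠ y) :
    Function.Injective (patchCode C x y : Centre J Unit → Code C J Unit) := by
  rintro (j | _ | _) (j' | _ | _) hij <;> simp_all [patchCode]

/-- A pair `(X, Y)` with the sum and product of `(x, y)` is `(x, y)` or `(y, x)`. So there is one
code per centre, the two Fay centres standing for the two orderings. -/
theorem setOf_coverCode_eq_inr {x y : ℂ} (hx : ‖x‖ < δ) (hy : ‖y‖ < δ)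
    (hxy : ‖x * y‖ < δ ^ 2 / 4) :
    {c : Code C J Unit | c.IsValid z δ ∧ coverCode h c = .inr (.inl ((), (x + y, x * y)))} =
      range (patchCode C x y) := by
  ext c
  constructor
  · rintro ⟨-, hc⟩
    rcases c with p | ⟨j, v⟩ | ⟨_, u, v⟩
    · cases hc
    · have := Sum.inl.inj (Sum.inr.inj hc)
      obtain rfl : v = (x + y, x * y) := (Prod.mk.inj this).2
      exact ⟨.inl j, rfl⟩
    · have := Sum.inl.inj (Sum.inr.inj hc)
      obtain ⟨h1, h2⟩ := Prod.mk.inj (Prod.mk.inj this).2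
      simp only at h1 h2
      have h3 : (u - x) * (u - y) = 0 := by linear_combination u * h1 - h2
      rcases mul_eq_zero.1 h3 with h4 | h4
      · obtain rfl := sub_eq_zero.1 h4
        obtain rfl : v = y := by linear_combination h1
        exact ⟨.inr (.inl ()), rfl⟩
      · obtain rfl := sub_eq_zero.1 h4
        obtain rfl : v = x := by linear_combination h1
        exact ⟨.inr (.inr ()), rfl⟩
  · rintro ⟨j | _ | _, rfl⟩
    · exact ⟨⟨hxy, x, y, rfl, rfl, hx, hy⟩, rfl⟩
    · exact ⟨⟨hxy, hx, hy⟩, rfl⟩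
    · refine ⟨⟨by rwa [mul_comm] at hxy, hy, hx⟩, ?_⟩
      simp only [patchCode, coverCode, add_comm, mul_comm]

theorem finite_setOf_sq_eq (s : ℂ) : {w : ℂ | w ^ 2 = s}.Finite := by
  obtain ⟨r, rfl⟩ := IsAlgClosed.exists_pow_nat_eq s (n := 2) (by norm_num)
  exact (toFinite {r, -r}).subset fun w hw => sq_eq_sq_iff_eq_or_eq_neg.1 hw

/-- Together with the injectivity of `code`, this turns counting points in a fibre of `H_t` into
counting valid codes. Surjectivity onto valid codes supplies the points, and these lie over `t`
because the map preserves the parameter. -/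
theorem image_fibreMap_preimage (ha : IsAdapted h z ze δ) (hC : Admissible a z δ)
    (hB : Admissible (ι := Centre Unit Empty) (fun _ => e) (fun _ => ze) δ) {t : ℂ}
    (P : Fibre hB t) :
    (fun Q : Fibre hC t => code hC Q.1) ''
        (fibreMap (coverMap ha hC hB) (proj_coverMap ha hC hB) t ⁻¹' {P}) =
      {c | c.IsValid z δ ∧ coverCode h c = code hB P.1} := by
  ext c
  constructor
  · rintro ⟨Q, hQ, rfl⟩
    exact ⟨isValid_code hC _, (coverMap_eq_iff ha hC hB).1 (congrArg Subtype.val hQ)⟩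
  · rintro ⟨hc, he⟩
    obtain ⟨m, rfl⟩ := exists_code_eq hC hc
    have hm := (coverMap_eq_iff ha hC hB).2 he
    exact ⟨⟨m, by rw [← proj_coverMap ha hC hB, hm]; exact P.2⟩, Subtype.ext hm, rfl⟩

/-- Outside the disc at `e` a fibre is one of `h`; inside, it is the range of `patchCode`, with one
element for each centre when the two roots differ. -/
theorem hasDegree_fibreMap [Finite J] (ha : IsAdapted h z ze δ) (hC : Admissible a z δ)
    (hB : Admissible (ι := Centre Unit Empty) (fun _ => e) (fun _ => ze) δ)
    (hdeg : HasDegree h (Nat.card (Centre J Unit))) (t : ℂ) :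
    HasDegree (fibreMap (coverMap ha hC hB) (proj_coverMap ha hC hB) t)
      (Nat.card (Centre J Unit)) := by
  have hinjC : Function.Injective (fun Q : Fibre hC t => code hC Q.1) :=
    (code_injective hC).comp Subtype.val_injective
  have hinjB : Function.Injective (fun P : Fibre hB t => code hB P.1) :=
    (code_injective hB).comp Subtype.val_injective
  -- a point of the fibre of `ℬ` is a point of `B` outside the disc or of the form `x + y`
  have hcase : ∀ P : Fibre hB t, (∃ y, code hB P.1 = .inl (y, t) ∧
      Code.IsValid (fun _ : Centre Unit Empty => ze) δ (.inl (y, t))) ∨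
      ∃ x y : ℂ, x * y = t ∧ ‖x‖ < δ ∧ ‖y‖ < δ ∧ ‖x * y‖ < δ ^ 2 / 4 ∧
        code hB P.1 = .inr (.inl ((), (x + y, x * y))) := by
    intro P
    have hv := isValid_code hB P.1
    have ht := (param_code hB P.1).trans P.2
    generalize code hB P.1 = c at hv ht
    rcases c with ⟨y, t'⟩ | ⟨_, w, t'⟩ | ⟨f, -⟩
    · obtain rfl : t' = t := ht
      exact .inl ⟨y, rfl, hv⟩
    · obtain ⟨ht', x, y, h1, h2, hx, hy⟩ := hv
      simp only at h1 h2
      subst h1 h2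
      exact .inr ⟨x, y, ht, hx, hy, ht', rfl⟩
    · exact f.elim
  have hinl : Function.Injective (fun x : C => (.inl (x, t) : Code C J Unit)) := fun x x' hx =>
    (Prod.mk.inj (Sum.inl.inj hx)).1
  constructor
  · intro P
    refine Set.Finite.of_finite_image ?_ hinjC.injOn
    rw [image_fibreMap_preimage]
    rcases hcase P with ⟨y, hy, hv⟩ | ⟨x, y, -, hx, hy, hxy, he⟩
    · rw [hy, setOf_coverCode_eq_inl ha hv]
      exact (hdeg.1 y).image _
    · rw [he, setOf_coverCode_eq_inr hx hy hxy]
      exact finite_range _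
  -- The possible exceptions are the exceptional points of `h` and the branch points of `u ↦ u + t /
  -- u`, where the discriminant `w ^ 2 - 4 t` vanishes.
  · refine (((hdeg.2.image fun y => .inl (y, t)).union ((finite_setOf_sq_eq (4 * t)).image
      fun w => .inr (.inl ((), (w, t))))).preimage hinjB.injOn).subset fun P hP => ?_
    rw [mem_ofPred_eq, ← ncard_image_of_injective _ hinjC, image_fibreMap_preimage] at hP
    rcases hcase P with ⟨y, hy, hv⟩ | ⟨x, y, ht, hx, hy, hxy, he⟩
    · rw [hy, setOf_coverCode_eq_inl ha hv, ncard_image_of_injective _ hinl] at hP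
      exact .inl ⟨y, hP, hy.symm⟩
    · rw [he, setOf_coverCode_eq_inr hx hy hxy] at hP
      obtain rfl : x = y := by
        by_contra hne
        rw [← Nat.card_coe_set_eq, Nat.card_range_of_injective (patchCode_injective hne)] at hP
        exact hP rfl
      refine .inr ⟨x + x, ?_, ?_⟩
      · rw [mem_ofPred_eq, ← ht]
        ring
      · refine Eq.trans ?_ he.symm
        simp only [ht]

end Degree

end FaySchiffer

/-! ### The theorem. -/

/-- A degree `m + 2` map `h : C → B`, unramified over `e`, induces a degree `m + 2` map over the disc
from the diagonal Fay–Schiffer variation of `C` centred at `h⁻¹(e)` to the Schiffer variation of `B`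
centred at `e`; the centres `a (inl j)` are `a₁, …, a_{n-2}`, and `a (inr (inl ()))`,
`a (inr (inr ()))` are `a_{n-1}`, `a_n`, where `n = m + 2`. -/
theorem mainTheorem6
    {C : Type*} [TopologicalSpace C] [T2Space C] [CompactSpace C] [ConnectedSpace C]
    [ChartedSpace ℂ C] [IsManifold 𝓘(ℂ, ℂ) ω C]
    {B : Type*} [TopologicalSpace B] [T2Space B] [CompactSpace B] [ConnectedSpace B]
    [ChartedSpace ℂ B] [IsManifold 𝓘(ℂ, ℂ) ω B]
    (m : ℕ) (h : C → B) (hh : ContMDiff 𝓘(ℂ, ℂ) 𝓘(ℂ, ℂ) ω h)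
    (hdeg : FaySchiffer.HasDegree h (m + 2))
    (e : B) (a : FaySchiffer.Centre (Fin m) Unit → C) (ha : Function.Injective a)
    (hae : range a = h ⁻¹' {e})
    (hunram : ∀ i, Function.Bijective (mfderiv 𝓘(ℂ, ℂ) 𝓘(ℂ, ℂ) h (a i)))
    -- a local coordinate at `e`
    (ze : OpenPartialHomeomorph B ℂ) (hze : ze ∈ IsManifold.maximalAtlas 𝓘(ℂ, ℂ) ω B)
    (hes : e ∈ ze.source) (he0 : ze e = 0)
    -- its pull-backs, as local coordinates on neighbourhoods of the points `a i`
    (z : FaySchiffer.Centre (Fin m) Unit → OpenPartialHomeomorph C ℂ)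
    (hz : ∀ i, z i ∈ IsManifold.maximalAtlas 𝓘(ℂ, ℂ) ω C)
    (has : ∀ i, a i ∈ (z i).source)
    (hzm : ∀ i, MapsTo h (z i).source ze.source)
    (hzh : ∀ i, EqOn (z i) (ze ∘ h) (z i).source) :
    (∃ δ₀ > 0, ∀ δ, 0 < δ → δ < δ₀ → FaySchiffer.Admissible a z δ ∧
      FaySchiffer.Admissible (ι := FaySchiffer.Centre Unit Empty)
        (fun _ => e) (fun _ => ze) δ) ∧
    ∀ (δ : ℝ) (hC : FaySchiffer.Admissible a z δ)
      (hB : FaySchiffer.Admissible (ι := FaySchiffer.Centre Unit Empty)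
        (fun _ => e) (fun _ => ze) δ),
      ∃ (H : FaySchiffer.Total hC → FaySchiffer.Total hB)
        (hH : ∀ x, FaySchiffer.proj hB (H x) = FaySchiffer.proj hC x),
        ContMDiff 𝓘(ℂ, ℂ × ℂ) 𝓘(ℂ, ℂ × ℂ) ω H ∧
        (∀ t : ℂ, ‖t‖ < δ ^ 2 / 4 →
          FaySchiffer.HasDegree (FaySchiffer.fibreMap H hH t) (m + 2)) ∧
        ∀ x : FaySchiffer.Nodal (a (.inr (.inl ()))) (a (.inr (.inr ()))),
          FaySchiffer.fibreMap H hH 0 (FaySchiffer.centralFibreNodal hC x) =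
            FaySchiffer.centralFibre hB
              (FaySchiffer.Nodal.map h (FaySchiffer.map_eq_of_range hae _ _) x) := by
  have hcard : Nat.card (FaySchiffer.Centre (Fin m) Unit) = m + 2 := by simp
  have hea : ∀ i, h (a i) = e := fun i => by
    have : a i ∈ h ⁻¹' {e} := hae ▸ mem_range_self i
    exact this
  constructor
  · obtain ⟨δ₁, h₁, H₁⟩ := FaySchiffer.exists_admissible ha hz has fun i => by
      rw [hzh i (has i), Function.comp_apply, hea, he0]
    obtain ⟨δ₂, h₂, H₂⟩ := FaySchiffer.exists_admissible
      (ι := FaySchiffer.Centre Unit Empty) (a := fun _ => e) (z := fun _ => ze)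
      -- `Centre Unit Empty` has a single element, so the constant family `e` is injective.
      (by rintro (_ | ⟨⟨⟩⟩ | ⟨⟨⟩⟩) (_ | ⟨⟨⟩⟩ | ⟨⟨⟩⟩) -; rfl) (fun _ => hze) (fun _ => hes) (fun _ => he0)
    exact ⟨min δ₁ δ₂, lt_min h₁ h₂, fun δ h0 hlt =>
      ⟨H₁ δ h0 (hlt.trans_le (min_le_left _ _)), H₂ δ h0 (hlt.trans_le (min_le_right _ _))⟩⟩
  · intro δ hC hB
    -- The degree has to be read as the number of centres: this equality makes the sections over the
    -- disc exhaust the fibres in `isAdapted`.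
    rw [← hcard] at hdeg ⊢
    have hA := FaySchiffer.isAdapted hh.continuous hdeg hC hzm hzh
    refine ⟨FaySchiffer.coverMap hA hC hB, FaySchiffer.proj_coverMap hA hC hB,
      FaySchiffer.contMDiff_coverMap hA hC hB hh,
      fun t _ => FaySchiffer.hasDegree_fibreMap hA hC hB hdeg t, ?_⟩
    rintro ⟨x⟩
    exact Subtype.ext (FaySchiffer.coverMap_centralMap hA hC hB x)
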